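/- Let $\mathbb{F}$ be a field, $n\ge 1$ and $0<\epsilon\le\eta<1$. Put $$d:=\Big\lceil \frac{1+\eta}{2\epsilon}\Big\rceil,\qquad M:=\Big\lceil \frac{2(1+\eta)\,d}{(1-\eta)^2}\Big\rceil ,$$ and suppose that $|\mathbb{F}|>d^2n^3$. Then there is an explicit $(\epsilon,\eta/\epsilon)$-dimension expander $A_1,\dots,A_D\in\mathbb{F}^{n\times n}$ of degree $$D=d\cdot M\;\le\;\lceil 1/\epsilon\rceil\cdot\Big\lceil \frac{4\lceil 1/\epsilon\rceil}{(1-\eta)^2}\Big\rceil .$$ Here $A_1,\dots,A_D$ (matrices counted with multiplicity) is an $(\epsilon,\alpha)$-dimension expander of degree $D$ if $\dim\sum_{i=1}^D A_i(V)\ge\alpha\dim V$ for every subspace $V\subseteq\mathbb{F}^n$ with $\dim V\le\epsilon n$. In particular, subspaces of dimension exactly $\epsilon n$ are expanded to dimension at least $\eta n$. Explicit means that there are one program and one polynomial $p$, the same for all $\mathbb{F},n,\epsilon,\eta$, such that the program, given $n$, $d$, $M$ and an index $i$, constructs $A_i$ in at most $p(n+\lfloor\log_2 D\rfloor)$ steps.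 A step is an arithmetic operation or a zero test in $\mathbb{F}$, an access to the $k$-th term of a given listing of elements of $\mathbb{F}$, or an assignment of a constant, addition, truncated subtraction or zero test on natural numbers. The listing may be any sequence in $\mathbb{F}$ whose terms with index $0\le k<|\mathbb{F}|$ are pairwise distinct; the matrices may depend on it. -/

import Mathlib

open scoped ENat

namespace DimExp

/-! ### Dimension expanders -/

/-- The indexed collection `A i` of `n × n` matrices is an `(ε, α)`-dimension expander: every
subspace `V` of `F ^ n` with `dim V ≤ ε n` satisfies `dim (∑ i, A i (V)) ≥ α dim V`.  Its degree is
the number of indices (matrices are counted with multiplicity). -/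
def IsDimensionExpander {F : Type*} [Field F] {n D : ℕ} (ε α : ℝ)
    (A : Fin D → Matrix (Fin n) (Fin n) F) : Prop :=
  ∀ V : Submodule F (Fin n → F), (Module.finrank F V : ℝ) ≤ ε * n →
    α * (Module.finrank F V : ℝ) ≤
      (Module.finrank F (⨆ i, V.map (A i).mulVecLin : Submodule F (Fin n → F)) : ℝ)

/-! ### Programs over a field, with a step count

A program is a finite piece of syntax that does not mention any field.  It works with
registers for natural numbers and with a memory of field elements; field operands are addressed
indirectly, through the contents of registers.  Natural numbers can only be set to constants,
added and subtracted, so that their bit length grows by at most one per step. -/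

/-- Elementary instructions, each of which is one step.  `e` below is a listing of elements
of the field, and `m` stands for the memory. -/
inductive Instr where
  /-- register `r := c` -/
  | natConst (r c : ℕ)
  /-- register `r := s + t` -/
  | natAdd (r s t : ℕ)
  /-- register `r := s - t`, truncated at zero -/
  | natSub (r s t : ℕ)
  /-- `m[r] := 0` -/
  | fieldZero (r : ℕ)
  /-- `m[r] := 1` -/
  | fieldOne (r : ℕ)
  /-- `m[r] := m[s] + m[t]` -/
  | fieldAdd (r s t : ℕ)
  /-- `m[r] := m[s] - m[t]` -/
  | fieldSub (r s t : ℕ)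
  /-- `m[r] := m[s] * m[t]` -/
  | fieldMul (r s t : ℕ)
  /-- `m[r] := m[s]⁻¹`, where the inverse of zero is zero -/
  | fieldInv (r s : ℕ)
  /-- `m[r] := ` the field element number `s` in the listing `e` -/
  | fieldEnum (r s : ℕ)

/-- Structured programs. -/
inductive Prog where
  | skip
  | instr (c : Instr)
  | seq (P Q : Prog)
  /-- if register `r` is zero then `P` else `Q` -/
  | ifNat (r : ℕ) (P Q : Prog)
  /-- if the field element `m[r]` is zero then `P` else `Q` -/
  | ifField (r : ℕ) (P Q : Prog)
  /-- while register `r` is nonzero, do `P` -/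
  | loop (r : ℕ) (P : Prog)

/-- Machine states: the registers and the memory. -/
structure State (F : Type*) where
  reg : ℕ → ℕ
  mem : ℕ → F

namespace State

variable {F : Type*}

def setReg (s : State F) (r v : ℕ) : State F :=
  { s with reg := Function.update s.reg r v }

/-- Write `x` into the memory cell whose address is the content of register `r`. -/
def setMem (s : State F) (r : ℕ) (x : F) : State F :=
  { s with mem := Function.update s.mem (s.reg r) x }

/-- The memory cell whose address is the content of register `r`. -/
def get (s : State F) (r : ℕ) : F := s.mem (s.reg r)

/-- The initial state: the input stands in the first registers, all else is zero. -/
def init [Zero F] (input : List ℕ) : State F where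
  reg k := input.getD k 0
  mem _ := 0

end State

/-- The effect of an elementary instruction. -/
def Instr.apply {F : Type*} [Field F] (e : ℕ → F) : Instr → State F → State F
  | .natConst r c, s => s.setReg r c
  | .natAdd r a b, s => s.setReg r (s.reg a + s.reg b)
  | .natSub r a b, s => s.setReg r (s.reg a - s.reg b)
  | .fieldZero r, s => s.setMem r 0
  | .fieldOne r, s => s.setMem r 1
  | .fieldAdd r a b, s => s.setMem r (s.get a + s.get b)
  | .fieldSub r a b, s => s.setMem r (s.get a - s.get b)
  | .fieldMul r a b, s => s.setMem r (s.get a * s.get b)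
  | .fieldInv r a, s => s.setMem r (s.get a)⁻¹
  | .fieldEnum r a, s => s.setMem r (e (s.reg a))

/-- `Exec e P s T s'`: started in state `s`, the program `P` halts in state `s'` after
exactly `T` steps, where every elementary instruction and every test is one step. -/
inductive Exec {F : Type*} [Field F] (e : ℕ → F) : Prog → State F → ℕ → State F → Prop
  | skip (s : State F) : Exec e .skip s 0 s
  | instr (c : Instr) (s : State F) : Exec e (.instr c) s 1 (c.apply e s)
  | seq {P Q : Prog} {s s' s'' : State F} {T T' : ℕ} :
      Exec e P s T s' → Exec e Q s' T' s'' → Exec e (.seq P Q) s (T + T') s''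
  | ifNat_zero {r : ℕ} {P Q : Prog} {s s' : State F} {T : ℕ} :
      s.reg r = 0 → Exec e P s T s' → Exec e (.ifNat r P Q) s (T + 1) s'
  | ifNat_ne {r : ℕ} {P Q : Prog} {s s' : State F} {T : ℕ} :
      s.reg r ≠ 0 → Exec e Q s T s' → Exec e (.ifNat r P Q) s (T + 1) s'
  | ifField_zero {r : ℕ} {P Q : Prog} {s s' : State F} {T : ℕ} :
      s.get r = 0 → Exec e P s T s' → Exec e (.ifField r P Q) s (T + 1) s'
  | ifField_ne {r : ℕ} {P Q : Prog} {s s' : State F} {T : ℕ} :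
      s.get r ≠ 0 → Exec e Q s T s' → Exec e (.ifField r P Q) s (T + 1) s'
  | loop_done {r : ℕ} {P : Prog} {s : State F} :
      s.reg r = 0 → Exec e (.loop r P) s 1 s
  | loop_step {r : ℕ} {P : Prog} {s s' s'' : State F} {T T' : ℕ} :
      s.reg r ≠ 0 → Exec e P s T s' → Exec e (.loop r P) s' T' s'' →
        Exec e (.loop r P) s (T + T' + 1) s''

/-- On the given input the program halts after exactly `T` steps with the matrix `A` written
row by row into the first `n * n` memory cells. -/
def Prog.Constructs {F : Type*} [Field F] {n : ℕ} (P : Prog) (e : ℕ → F) (input : List ℕ)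
    (T : ℕ) (A : Matrix (Fin n) (Fin n) F) : Prop :=
  ∃ s : State F, Exec e P (State.init input) T s ∧
    ∀ a b : Fin n, s.mem ((a : ℕ) * n + (b : ℕ)) = A a b

/-- `e` lists elements of `F` without repetition as long as this is possible: for finite `F` the
first `|F|` terms are all the elements of `F`, and for infinite `F` all terms are distinct. -/
def IsListing {F : Type*} (e : ℕ → F) : Prop :=
  Set.InjOn e {k : ℕ | (k : ℕ∞) < ENat.card F}

/-- The collection `A` of `D` matrices of size `n × n` is explicit by means of the program `P` and
the polynomial `p`: given `n`, the integer parameters `params` of the collection and an index `i`,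
the program constructs the `i`-th matrix in at most `p (n + log D)` steps.  (A bound that is
polynomial in `n` and `log D` is the same as one that is polynomial in their sum.) -/
def ExplicitBy {F : Type*} [Field F] {n D : ℕ} (P : Prog) (p : Polynomial ℕ) (e : ℕ → F)
    (params : List ℕ) (A : Fin D → Matrix (Fin n) (Fin n) F) : Prop :=
  ∀ i : Fin D, ∃ T : ℕ, T ≤ p.eval (n + Nat.log 2 D) ∧
    P.Constructs e (n :: (i : ℕ) :: params) T (A i)

end DimExp

/-!
The matrices come from a rank condenser. A vector of `d` blocks of `n` coefficients is read as a
polynomial of degree less than `N = n d`, and a polynomial `f` is condensed to its values at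
`α, ω α, …, ω ^ (n - 1) α`. Matrix number `j d + l` is the restriction of the condenser at the
point `α j` to block `l`. The images of `V` under the `d` matrices of the point `α j` therefore
span the condensed image of `V ⊗ F ^ d`, and it suffices that for each `V` some point loses little
dimension on an `r`-dimensional subspace `W` of `V ⊗ F ^ d`, where `r = ⌈(1 + η) dim V / (2 ε)⌉`.

The loss is bounded by means of the folded Wronskian determinant `det (f j (ω ^ i X))` of a basis
of `W`. It is nonzero if the order of `ω` is at least `N`, because `W` contains `r` polynomials of
distinct degrees and the top coefficient is a Vandermonde determinant in powers of `ω`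
(`det_foldedWronskian_basis_ne_zero`). If the condenser at `α` loses `a` dimensions on `W`, then
the determinant vanishes to order at least `a` at each of `α, ω α, …, ω ^ (n - r) α`
(`pow_dvd_det_foldedWronskian`). If all these roots are distinct for the various points, then the
losses add up to at most `r (N - 1) / (n - r + 1)` (`sum_finrank_ker_foldedEval_le`), so that among
`M` points one has a loss small enough. No more than `n² d` points are ever needed, since with so
many points one of them has no loss at all (`isDimensionExpander_of_condenserBlock`).

For explicitness, `ω` is the first listed element of order greater than `N`, and the points are
chosen greedily along the listing, each of them outside the set of the `ω ^ i α j` with `|i| < n`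
for the earlier points. Counting shows that both searches end within `d² n³` terms. If `d > n`,
then only `V = 0` has dimension at most `ε n`, and the zero matrices do; otherwise all
quantities, including the number of matrices that differ from zero, are polynomial in `n` alone.
The program carries out these searches literally (`runs_expanderProg`); its correctness and its
running time are verified together, by a calculus for the predicate `Runs`.
-/

namespace DimExp

variable {F : Type*} [Field F]

section

open Polynomial

/-! ### Determinants of polynomial matrices -/

theorem prod_dvd_det_of_dvd_column {R m : Type*} [CommRing R] [Fintype m] [DecidableEq m]
    (A : Matrix m m R) (v : m → R) (h : ∀ i j, v j ∣ A i j) : ∏ j, v j ∣ A.det := by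
  choose B hB using h
  have : A = Matrix.of fun i j => v j * B i j := by
    ext i j
    simp [hB i j]
  rw [this]
  exact ⟨_, Matrix.det_mul_row v B⟩

theorem natDegree_det_le_sum {R m : Type*} [CommRing R] [Fintype m] [DecidableEq m]
    (A : Matrix m m R[X]) (b : m → ℕ) (h : ∀ i j, (A i j).natDegree ≤ b j) :
    A.det.natDegree ≤ ∑ j, b j := by
  rw [Matrix.det_apply]
  refine natDegree_sum_le_of_forall_le _ _ fun σ _ => ?_
  refine (natDegree_smul_le _ _).trans ((natDegree_prod_le _ _).trans ?_)
  exact Finset.sum_le_sum fun i _ => h _ _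

theorem coeff_prod_sum_of_natDegree_le {R m : Type*} [CommSemiring R] (s : Finset m)
    (f : m → R[X]) (b : m → ℕ) (h : ∀ j, (f j).natDegree ≤ b j) :
    (∏ j ∈ s, f j).coeff (∑ j ∈ s, b j) = ∏ j ∈ s, (f j).coeff (b j) := by
  classical
  induction s using Finset.induction_on with
  | empty => simp
  | insert a s ha ih =>
    rw [Finset.prod_insert ha, Finset.sum_insert ha, Finset.prod_insert ha, ← ih]
    refine coeff_mul_add_eq_of_natDegree_le (h a) ((natDegree_prod_le _ _).trans ?_)
    exact Finset.sum_le_sum fun i _ => h _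

theorem coeff_det_of_natDegree_le {R m : Type*} [CommRing R] [Fintype m] [DecidableEq m]
    (A : Matrix m m R[X]) (b : m → ℕ) (h : ∀ i j, (A i j).natDegree ≤ b j) :
    A.det.coeff (∑ j, b j) = (Matrix.of fun i j => (A i j).coeff (b j)).det := by
  rw [Matrix.det_apply, Matrix.det_apply, finsetSum_coeff]
  refine Finset.sum_congr rfl fun σ _ => ?_
  rw [Units.smul_def, Units.smul_def, coeff_smul]
  congr 1
  simpa using coeff_prod_sum_of_natDegree_le Finset.univ (fun j => A (σ j) j) b fun j => h _ j

/-! ### The folded Wronskian -/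

/-- The folded Wronskian matrix of the polynomials `f j` with respect to `ω`: its entry in row `i`
and column `j` is `f j (ω ^ i X)`. -/
noncomputable def foldedWronskian {r : ℕ} (ω : F) (f : Fin r → F[X]) :
    Matrix (Fin r) (Fin r) F[X] :=
  Matrix.of fun i j => (f j).comp (C (ω ^ (i : ℕ)) * X)

theorem natDegree_comp_C_mul_X_le (p : F[X]) (a : F) :
    (p.comp (C a * X)).natDegree ≤ p.natDegree := by
  refine natDegree_comp_le.trans ?_
  calc p.natDegree * (C a * X).natDegree ≤ p.natDegree * 1 :=
        Nat.mul_le_mul_left _ ((natDegree_C_mul_le a X).trans natDegree_X_le)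
    _ = _ := mul_one _

theorem natDegree_det_foldedWronskian_le {r N : ℕ} (ω : F) (f : Fin r → F[X])
    (h : ∀ j, (f j).natDegree ≤ N) : (foldedWronskian ω f).det.natDegree ≤ r * N := by
  refine (natDegree_det_le_sum _ (fun _ => N) fun i j => ?_).trans (by simp)
  exact (natDegree_comp_C_mul_X_le _ _).trans (h j)

/-- The coefficient of the folded Wronskian determinant in the largest conceivable degree is a
Vandermonde determinant, up to the leading coefficients. -/
theorem det_foldedWronskian_ne_zero_of_natDegree_injective {r N : ℕ} {ω : F}
    (hω : Set.InjOn (fun k : ℕ => ω ^ k) {k | k < N}) (f : Fin r → F[X])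
    (h0 : ∀ j, f j ≠ 0) (hN : ∀ j, (f j).natDegree < N)
    (hf : Function.Injective fun j => (f j).natDegree) : (foldedWronskian ω f).det ≠ 0 := by
  intro h
  have key := coeff_det_of_natDegree_le (foldedWronskian ω f) (fun j => (f j).natDegree)
    fun i j => natDegree_comp_C_mul_X_le _ _
  have hM : (Matrix.of fun i j : Fin r => (foldedWronskian ω f i j).coeff ((f j).natDegree))
      = Matrix.of fun i j => (f j).leadingCoeff *
          (Matrix.vandermonde fun j => ω ^ (f j).natDegree).transpose i j := by
    ext i j
    simp only [foldedWronskian, Matrix.of_apply, comp_C_mul_X_coeff, Matrix.transpose_apply,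
      Matrix.vandermonde_apply, leadingCoeff]
    rw [← pow_mul, ← pow_mul, mul_comm (i : ℕ)]
  rw [h, hM, Matrix.det_mul_row, Matrix.det_transpose, coeff_zero] at key
  refine mul_ne_zero (Finset.prod_ne_zero_iff.2 fun j _ => leadingCoeff_ne_zero.2 (h0 j)) ?_
    key.symm
  refine Matrix.det_vandermonde_ne_zero_iff.2 fun i j hij => hf ?_
  exact hω (hN i) (hN j) hij

/-- A space of polynomials of dimension at least `r` contains `r` nonzero polynomials of pairwise
distinct degrees. -/
theorem exists_natDegree_injective (N : ℕ) : ∀ (W : Submodule F F[X]), W ≤ degreeLT F N →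
    ∀ r ≤ Module.finrank F W, ∃ f : Fin r → F[X], (∀ j, f j ∈ W) ∧ (∀ j, f j ≠ 0) ∧
      Function.Injective fun j => (f j).natDegree := by
  induction N with
  | zero =>
    intro W hW r hr
    have : W = ⊥ := by
      rw [eq_bot_iff]
      intro p hp
      have := mem_degreeLT.1 (hW hp)
      simpa using this
    subst this
    have : r = 0 := by simpa using hr
    subst this
    exact ⟨fun _ => 0, fun j => j.elim0, fun j => j.elim0, fun j => j.elim0⟩
  | succ N ih =>
    intro W hW r hr
    by_cases hle : W ≤ degreeLT F N
    · exact ih W hle r hr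
    obtain ⟨g, hgW, hgN⟩ := Set.not_subset.1 hle
    have hgdeg : g.natDegree = N := by
      have h1 : g.degree < (N + 1 : ℕ) := mem_degreeLT.1 (hW hgW)
      have h2 : ¬ g.degree < N := fun h => hgN (mem_degreeLT.2 h)
      have h0 : g ≠ 0 := by
        rintro rfl
        exact h2 (by simp)
      rw [degree_eq_natDegree h0] at h1 h2
      have h1' : g.natDegree < N + 1 := by exact_mod_cast h1
      have h2' : ¬ g.natDegree < N := by exact_mod_cast h2
      omega
    have hg0 : g ≠ 0 := by
      rintro rfl
      exact hgN (by simp)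
    obtain _ | r := r
    · exact ⟨fun _ => 0, fun j => j.elim0, fun j => j.elim0, fun j => j.elim0⟩
    have : FiniteDimensional F W := by
      have : FiniteDimensional F (degreeLT F (N + 1)) :=
        Module.Finite.equiv (degreeLTEquiv F (N + 1)).symm
      exact Submodule.finiteDimensional_of_le hW
    -- The coefficient of `X ^ N` is a functional on `W` whose kernel is `W ⊓ degreeLT F N`.
    let φ : W →ₗ[F] F := (lcoeff F N).comp W.subtype
    have hker : (LinearMap.ker φ).map W.subtype ≤ W ⊓ degreeLT F N := by
      rintro _ ⟨⟨p, hp⟩, hpk, rfl⟩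
      refine ⟨hp, mem_degreeLT.2 ?_⟩
      have hc : p.coeff N = 0 := hpk
      have hd : p.degree < (N + 1 : ℕ) := mem_degreeLT.1 (hW hp)
      rw [degree_lt_iff_coeff_zero] at hd ⊢
      intro m hm
      rcases eq_or_lt_of_le hm with rfl | hm
      · exact hc
      · exact hd m hm
    have hfin := LinearMap.finrank_range_add_finrank_ker φ
    have hr1 : Module.finrank F (LinearMap.range φ) ≤ 1 := by
      simpa using Submodule.finrank_le (LinearMap.range φ)
    have : FiniteDimensional F (W ⊓ degreeLT F N : Submodule F F[X]) :=
      Submodule.finiteDimensional_of_le inf_le_left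
    have hk : Module.finrank F (LinearMap.ker φ) ≤
        Module.finrank F (W ⊓ degreeLT F N : Submodule F F[X]) := by
      rw [← Submodule.finrank_map_subtype_eq]
      exact Submodule.finrank_mono hker
    obtain ⟨f, hfW, hf0, hfi⟩ := ih (W ⊓ degreeLT F N) inf_le_right r (by omega)
    have hlt : ∀ j, (f j).natDegree < N := fun j =>
      (natDegree_lt_iff_degree_lt (hf0 j)).2 (mem_degreeLT.1 (hfW j).2)
    refine ⟨Fin.cons g f, ?_, ?_, ?_⟩
    · intro j
      refine Fin.cases ?_ (fun j => ?_) j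
      · simpa using hgW
      · simpa using (hfW j).1
    · intro j
      refine Fin.cases ?_ (fun j => ?_) j
      · simpa using hg0
      · simpa using hf0 j
    · intro i j
      refine Fin.cases ?_ (fun i => ?_) i <;> refine Fin.cases ?_ (fun j => ?_) j
      · simp
      · intro h
        have := hlt j
        simp only [Fin.cons_zero, Fin.cons_succ, hgdeg] at h
        omega
      · intro h
        have := hlt i
        simp only [Fin.cons_zero, Fin.cons_succ, hgdeg] at h
        omega
      · intro h
        simp only [Fin.cons_succ] at h
        exact congrArg _ (hfi h)

/-- Passing from a basis to another family multiplies the folded Wronskian determinant by the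
constant determinant of the transition matrix. -/
theorem det_foldedWronskian_toMatrix {r : ℕ} (ω : F) {W : Submodule F F[X]}
    (b : Module.Basis (Fin r) F W) (f : Fin r → W) :
    (foldedWronskian ω fun j => (f j : F[X])).det =
      (foldedWronskian ω fun j => (b j : F[X])).det * C (b.toMatrix f).det := by
  have : foldedWronskian ω (fun j => (f j : F[X])) =
      foldedWronskian ω (fun j => (b j : F[X])) * (b.toMatrix f).map C := by
    ext1 i j
    have h : (f j : F[X]) = ∑ k, b.toMatrix f k j • (b k : F[X]) := by
      calc (f j : F[X]) = W.subtype (∑ k, b.toMatrix f k j • b k) := by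
            rw [b.sum_toMatrix_smul_self f j, Submodule.subtype_apply]
        _ = _ := by rw [map_sum]; rfl
    simp only [foldedWronskian, Matrix.of_apply, Matrix.mul_apply, Matrix.map_apply]
    rw [h, ← coe_compRingHom_apply, map_sum]
    refine Finset.sum_congr rfl fun k _ => ?_
    simp [smul_eq_C_mul, mul_comm]
  rw [this, Matrix.det_mul]
  congr 1
  exact (RingHom.map_det C (b.toMatrix f)).symm

theorem det_foldedWronskian_basis_ne_zero {r N : ℕ} {ω : F}
    (hω : Set.InjOn (fun k : ℕ => ω ^ k) {k | k < N}) {W : Submodule F F[X]}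
    (hW : W ≤ degreeLT F N) (b : Module.Basis (Fin r) F W) :
    (foldedWronskian ω fun j => (b j : F[X])).det ≠ 0 := by
  have hr : Module.finrank F W = r := by simpa using Module.finrank_eq_card_basis b
  obtain ⟨f, hfW, hf0, hfi⟩ := exists_natDegree_injective N W hW r hr.ge
  have h := det_foldedWronskian_ne_zero_of_natDegree_injective hω f hf0
    (fun j => (natDegree_lt_iff_degree_lt (hf0 j)).2 (mem_degreeLT.1 (hW (hfW j)))) hfi
  have h2 := det_foldedWronskian_toMatrix ω b (fun j => ⟨f j, hfW j⟩)
  exact left_ne_zero_of_mul (h2 ▸ h)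

/-- If the polynomials in `U ≤ W` vanish at `β, ω β, …, ω ^ (r - 1) β`, then `β` is a root of
multiplicity at least `dim U` of the folded Wronskian determinant: in a basis of `W` extending a
basis of `U`, each of `dim U` columns is divisible by `X - β`. -/
theorem pow_dvd_det_foldedWronskian {r : ℕ} (ω β : F) {W : Submodule F F[X]}
    (b : Module.Basis (Fin r) F W) (U : Submodule F W)
    (hU : ∀ f ∈ U, ∀ i < r, (f : F[X]).eval (ω ^ i * β) = 0) :
    (X - C β) ^ Module.finrank F U ∣ (foldedWronskian ω fun j => (b j : F[X])).det := by
  have : FiniteDimensional F W := Module.Finite.of_basis b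
  obtain ⟨V, hV⟩ := U.exists_isCompl
  have : Module.Free F U := Module.Free.of_divisionRing F U
  have : Module.Free F V := Module.Free.of_divisionRing F V
  let c' := ((Module.finBasis F U).prod (Module.finBasis F V)).map
    (Submodule.prodEquivOfIsCompl U V hV)
  let e := c'.indexEquiv b
  let c := c'.reindex e
  have hc : ∀ i, c (e (Sum.inl i)) ∈ U := by
    intro i
    simp [c, c', Module.Basis.prod_apply]
  rw [show (fun j => (b j : F[X])) = fun j => ((⇑b) j : F[X]) from rfl,
    det_foldedWronskian_toMatrix ω c b]
  refine Dvd.dvd.mul_right ?_ _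
  let v : Fin r → F[X] := fun j => Sum.elim (fun _ => X - C β) (fun _ => 1) (e.symm j)
  have hv : ∏ j, v j = (X - C β) ^ Module.finrank F U := by
    rw [← Equiv.prod_comp e, Fintype.prod_sum_type]
    simp [v]
  rw [← hv]
  refine prod_dvd_det_of_dvd_column _ _ fun i j => ?_
  obtain ⟨k, rfl⟩ := e.surjective j
  rcases k with k | k
  · simp only [v, Equiv.symm_apply_apply, Sum.elim_inl, foldedWronskian, Matrix.of_apply]
    rw [dvd_iff_isRoot, IsRoot.def, eval_comp]
    simpa using hU _ (hc k) i i.2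
  · simp [v]

/-! ### The rank condenser -/

/-- Folded evaluation at `α`: the values of a polynomial at `α, ω α, …, ω ^ (n - 1) α`. -/
noncomputable def foldedEval (ω : F) (n : ℕ) (α : F) : F[X] →ₗ[F] (Fin n → F) :=
  LinearMap.pi fun i => leval (ω ^ (i : ℕ) * α)

theorem foldedEval_apply (ω : F) (n : ℕ) (α : F) (p : F[X]) (i : Fin n) :
    foldedEval ω n α p i = p.eval (ω ^ (i : ℕ) * α) := rfl

/-- The total loss of dimension of `W` under the folded evaluations at the points `α j`, each
weighted by `n - r + 1` with `r = dim W`, is at most the degree of the folded Wronskian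
determinant of `W`. -/
theorem sum_finrank_ker_foldedEval_le {N n r K : ℕ} {ω : F}
    (hω : Set.InjOn (fun k : ℕ => ω ^ k) {k | k < N}) {W : Submodule F F[X]}
    (hW : W ≤ degreeLT F N) (hr : Module.finrank F W = r) (hrn : r ≤ n) (α : ℕ → F)
    (hα : Set.InjOn (fun x : ℕ × ℕ => ω ^ x.2 * α x.1) {x | x.1 < K ∧ x.2 < n}) (hr0 : 0 < r) :
    (∑ j ∈ Finset.range K,
      Module.finrank F (LinearMap.ker ((foldedEval ω n (α j)).comp W.subtype))) * (n - r + 1)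
      ≤ r * (N - 1) := by
  have : FiniteDimensional F W := .of_finrank_pos (by omega)
  let b : Module.Basis (Fin r) F W := Module.finBasisOfFinrankEq F W hr
  let D := (foldedWronskian ω fun j => (b j : F[X])).det
  have hD : D ≠ 0 := det_foldedWronskian_basis_ne_zero hω hW b
  have hdeg : D.natDegree ≤ r * (N - 1) := by
    refine natDegree_det_foldedWronskian_le ω _ fun j => ?_
    have h0 : (b j : F[X]) ≠ 0 := by simpa using b.ne_zero j
    have := (natDegree_lt_iff_degree_lt h0).2 (mem_degreeLT.1 (hW (b j).2))
    omega
  let a : ℕ → ℕ := fun j =>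
    Module.finrank F (LinearMap.ker ((foldedEval ω n (α j)).comp W.subtype))
  have hdvd : ∏ x ∈ Finset.range K ×ˢ Finset.range (n - r + 1),
      (X - C (ω ^ x.2 * α x.1)) ^ a x.1 ∣ D := by
    refine Finset.prod_dvd_of_coprime ?_ ?_
    · intro x hx y hy hxy
      simp only [Finset.coe_product, Finset.coe_range, Set.mem_prod, Set.mem_Iio] at hx hy
      refine IsCoprime.pow (isCoprime_X_sub_C_of_isUnit_sub (IsUnit.mk0 _ ?_))
      rw [sub_ne_zero]
      intro h
      exact hxy (hα ⟨hx.1, by omega⟩ ⟨hy.1, by omega⟩ h)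
    · rintro ⟨j, s⟩ hx
      simp only [Finset.mem_product, Finset.mem_range] at hx
      refine pow_dvd_det_foldedWronskian ω _ b _ fun f hf i hi => ?_
      have h := congrFun (LinearMap.mem_ker.1 hf) ⟨i + s, by omega⟩
      rw [LinearMap.comp_apply, foldedEval_apply] at h
      rw [← mul_assoc, ← pow_add]
      exact h
  have hle := natDegree_le_of_dvd hdvd hD
  rw [natDegree_prod_of_monic _ _ fun x _ => (monic_X_sub_C _).pow _] at hle
  simp only [natDegree_pow, natDegree_X_sub_C, mul_one, Finset.sum_product, Finset.sum_const,
    Finset.card_range, smul_eq_mul] at hle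
  rw [Finset.sum_mul]
  refine le_trans (le_of_eq ?_) (hle.trans hdeg)
  exact Finset.sum_congr rfl fun j _ => mul_comm _ _

theorem finrank_map_add_finrank_ker_domRestrict {E G : Type*} [AddCommGroup E] [Module F E]
    [AddCommGroup G] [Module F G] (φ : E →ₗ[F] G) (W : Submodule F E) [FiniteDimensional F W] :
    Module.finrank F (W.map φ) + Module.finrank F (LinearMap.ker (φ.comp W.subtype)) =
      Module.finrank F W := by
  rw [← LinearMap.finrank_range_add_finrank_ker (φ.comp W.subtype), LinearMap.range_comp,
    Submodule.range_subtype]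

/-! ### From the condenser to a dimension expander -/

/-- The matrix with entries `(ω ^ a α) ^ (n l + b)`: it sends the coefficient vector `v` to the
folded evaluation at `α` of the polynomial `∑ b, v b X ^ (n l + b)`. -/
def condenserBlock (n : ℕ) (ω α : F) (l : ℕ) : Matrix (Fin n) (Fin n) F :=
  Matrix.of fun a b => (ω ^ (a : ℕ) * α) ^ (n * l + (b : ℕ))

/-- The identification of `d` blocks of `n` coefficients with a polynomial of degree less
than `n d`. -/
noncomputable def blockPoly (F : Type*) [Field F] (n d : ℕ) : (Fin d → Fin n → F) →ₗ[F] F[X] :=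
  ∑ l : Fin d, ∑ b : Fin n, (monomial (n * (l : ℕ) + (b : ℕ))).comp
    ((LinearMap.proj b : (Fin n → F) →ₗ[F] F).comp
      (LinearMap.proj l : (Fin d → Fin n → F) →ₗ[F] Fin n → F))

theorem blockPoly_apply (n d : ℕ) (v : Fin d → Fin n → F) :
    blockPoly F n d v = ∑ l : Fin d, ∑ b : Fin n, monomial (n * (l : ℕ) + (b : ℕ)) (v l b) := by
  simp [blockPoly]

theorem block_index_injective {n d : ℕ} :
    Function.Injective fun x : Fin d × Fin n => n * (x.1 : ℕ) + (x.2 : ℕ) := by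
  rintro ⟨l, b⟩ ⟨l', b'⟩ h
  have hb := b.2
  have hb' := b'.2
  have hn : 0 < n := by omega
  have h1 : (n * (l : ℕ) + b) / n = (n * (l' : ℕ) + b') / n := congrArg (· / n) h
  rw [Nat.mul_add_div hn, Nat.mul_add_div hn, Nat.div_eq_of_lt hb, Nat.div_eq_of_lt hb'] at h1
  have h2 : (n * (l : ℕ) + b) % n = (n * (l' : ℕ) + b') % n := congrArg (· % n) h
  rw [Nat.mul_add_mod, Nat.mul_add_mod, Nat.mod_eq_of_lt hb, Nat.mod_eq_of_lt hb'] at h2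
  simp only [Prod.mk.injEq]
  exact ⟨Fin.ext (by simpa using h1), Fin.ext h2⟩

theorem coeff_blockPoly (n d : ℕ) (v : Fin d → Fin n → F) (l : Fin d) (b : Fin n) :
    (blockPoly F n d v).coeff (n * (l : ℕ) + (b : ℕ)) = v l b := by
  rw [blockPoly_apply, ← Fintype.sum_prod_type'
    (f := fun (l : Fin d) (b : Fin n) => monomial (n * (l : ℕ) + (b : ℕ)) (v l b)), finsetSum_coeff,
    Finset.sum_eq_single (l, b)]
  · simp
  · intro x _ hx
    rw [coeff_monomial, if_neg]
    exact fun h => hx (block_index_injective h)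
  · simp

theorem blockPoly_injective (n d : ℕ) : Function.Injective (blockPoly F n d) := by
  intro v w h
  ext l b
  rw [← coeff_blockPoly n d v l b, h, coeff_blockPoly]

theorem blockPoly_mem_degreeLT (n d : ℕ) (v : Fin d → Fin n → F) :
    blockPoly F n d v ∈ degreeLT F (n * d) := by
  rw [blockPoly_apply]
  refine Submodule.sum_mem _ fun l _ => Submodule.sum_mem _ fun b _ => ?_
  refine mem_degreeLT.2 ((degree_monomial_le _ _).trans_lt ?_)
  have h : n * ((l : ℕ) + 1) ≤ n * d := Nat.mul_le_mul_left n l.2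
  have := b.2
  rw [mul_add] at h
  exact_mod_cast (by omega : n * (l : ℕ) + b < n * d)

theorem foldedEval_blockPoly (ω α : F) (n d : ℕ) (v : Fin d → Fin n → F) :
    foldedEval ω n α (blockPoly F n d v) =
      ∑ l : Fin d, (condenserBlock n ω α l).mulVecLin (v l) := by
  ext a
  rw [foldedEval_apply, blockPoly_apply, eval_finsetSum, Finset.sum_apply]
  refine Finset.sum_congr rfl fun l _ => ?_
  rw [eval_finsetSum, Matrix.mulVecLin_apply, Matrix.mulVec, dotProduct]
  refine Finset.sum_congr rfl fun b _ => ?_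
  simp [condenserBlock, eval_monomial, mul_comm]

/-- The blocks belonging to `α j` map `V` onto a space whose dimension falls short of `r` by at
most `loss j`, and the losses are small on average. -/
theorem exists_loss {n d r K : ℕ} {ω : F}
    (hω : Set.InjOn (fun k : ℕ => ω ^ k) {k | k < n * d}) (α : ℕ → F)
    (hα : Set.InjOn (fun x : ℕ × ℕ => ω ^ x.2 * α x.1) {x | x.1 < K ∧ x.2 < n})
    (V : Submodule F (Fin n → F)) (hr0 : 0 < r) (hrn : r ≤ n)
    (hrV : r ≤ d * Module.finrank F V) :
    ∃ loss : ℕ → ℕ,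
      (∀ j, r ≤ Module.finrank F (⨆ l : Fin d, V.map (condenserBlock n ω (α j) l).mulVecLin :
        Submodule F (Fin n → F)) + loss j) ∧
      (∑ j ∈ Finset.range K, loss j) * (n - r + 1) ≤ r * (n * d - 1) := by
  have hfin : Module.finrank F (Fin d → V) = d * Module.finrank F V := by
    simp [Module.finrank_pi_fintype]
  obtain ⟨f, hf⟩ := exists_linearIndependent_of_le_finrank (R := F) (hfin ▸ hrV)
  let φ : (Fin d → V) →ₗ[F] F[X] := (blockPoly F n d).comp
    (LinearMap.pi fun l => V.subtype.comp (LinearMap.proj l))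
  have hφ : Function.Injective φ := by
    refine (blockPoly_injective n d).comp fun x y h => ?_
    ext l b
    exact congrFun (congrFun h l) b
  have hφf := hf.map' φ (LinearMap.ker_eq_bot.2 hφ)
  let W : Submodule F F[X] := Submodule.span F (Set.range (φ ∘ f))
  have hWr : Module.finrank F W = r := by simpa using finrank_span_eq_card hφf
  have : FiniteDimensional F W := .of_finrank_pos (by omega)
  have hWφ : W ≤ LinearMap.range φ := by
    refine Submodule.span_le.2 ?_
    rintro _ ⟨i, rfl⟩
    exact ⟨f i, rfl⟩
  have hW : W ≤ degreeLT F (n * d) := by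
    intro p hp
    obtain ⟨v, rfl⟩ := hWφ hp
    exact blockPoly_mem_degreeLT n d _
  refine ⟨fun j => Module.finrank F (LinearMap.ker ((foldedEval ω n (α j)).comp W.subtype)),
    fun j => ?_, sum_finrank_ker_foldedEval_le hω hW hWr hrn α hα hr0⟩
  rw [← hWr, ← finrank_map_add_finrank_ker_domRestrict (foldedEval ω n (α j)) W]
  refine Nat.add_le_add_right (Submodule.finrank_mono ?_) _
  rintro _ ⟨p, hp, rfl⟩
  obtain ⟨v, rfl⟩ := hWφ hp
  rw [LinearMap.comp_apply, foldedEval_blockPoly]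
  refine Submodule.sum_mem _ fun l _ => ?_
  exact Submodule.mem_iSup_of_mem l (Submodule.mem_map_of_mem (v l).2)

/-- If a nonzero space has dimension at most `ε n`, so that `1 ≤ ε n`, then `d ≤ n`. -/
theorem ceil_div_two_mul_le_of_mul_ge_one {n : ℕ} {ε η : ℝ} (hε : 0 < ε) (hη : η < 1)
    (hn : 1 ≤ ε * n) : ⌈(1 + η) / (2 * ε)⌉₊ ≤ n := by
  refine Nat.ceil_le.2 ?_
  rw [div_le_iff₀ (by positivity)]
  nlinarith

/-- Either `M` points or at least `n² d` points suffice: with `M` points the average loss is small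
enough, and with `n² d` points some point has no loss at all. -/
theorem isDimensionExpander_of_condenserBlock {n d M K D : ℕ} {ε η : ℝ} {ω : F}
    (hε : 0 < ε) (hεη : ε ≤ η) (hη : η < 1)
    (hd : d = ⌈(1 + η) / (2 * ε)⌉₊) (hM : M = ⌈2 * (1 + η) * (d : ℝ) / (1 - η) ^ 2⌉₊)
    (hK : K = M ∨ n * n * d ≤ K)
    (hω : Set.InjOn (fun k : ℕ => ω ^ k) {k | k < n * d}) (α : ℕ → F)
    (hα : Set.InjOn (fun x : ℕ × ℕ => ω ^ x.2 * α x.1) {x | x.1 < K ∧ x.2 < n})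
    (A : Fin D → Matrix (Fin n) (Fin n) F)
    (hA : ∀ j < K, ∀ l < d, ∃ i, A i = condenserBlock n ω (α j) l) :
    IsDimensionExpander ε (η / ε) A := by
  intro V hV
  set v := Module.finrank F V with hv
  rcases Nat.eq_zero_or_pos v with h0 | hv0
  · rw [h0]
    simp
  have hη0 : 0 < η := hε.trans_le hεη
  have hv1 : (1 : ℝ) ≤ v := by exact_mod_cast hv0
  have hn0 : (0 : ℝ) < n := by
    rcases Nat.eq_zero_or_pos n with h | h
    · subst h
      simp only [Nat.cast_zero, mul_zero] at hV
      linarith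
    · exact_mod_cast h
  have hn0' : 0 < n := by exact_mod_cast hn0
  have hd0 : 0 < d := hd ▸ Nat.ceil_pos.2 (by positivity)
  -- The dimension after tensoring that the condenser is applied to.
  set ρ : ℝ := (1 + η) / (2 * ε) * v with hρ
  have hρ0 : 0 < ρ := by positivity
  set r := ⌈ρ⌉₊ with hr
  have hρr : ρ ≤ r := Nat.le_ceil ρ
  have hrρ : (r : ℝ) < ρ + 1 := Nat.ceil_lt_add_one hρ0.le
  have hρn : ρ ≤ (1 + η) / 2 * n := by
    have : ρ = (1 + η) / 2 * (v / ε) := by rw [hρ]; field_simp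
    rw [this]
    refine mul_le_mul_of_nonneg_left ?_ (by positivity)
    rw [div_le_iff₀ hε]
    linarith
  have hr0 : 0 < r := Nat.ceil_pos.2 hρ0
  have hrV : r ≤ d * v := by
    refine Nat.ceil_le.2 ?_
    rw [Nat.cast_mul]
    refine mul_le_mul_of_nonneg_right ?_ (by positivity)
    rw [hd]
    exact Nat.le_ceil _
  have hrn : r ≤ n := by
    have : (r : ℝ) < n + 1 := by nlinarith
    exact Nat.lt_succ_iff.1 (by exact_mod_cast this)
  obtain ⟨loss, hloss, hsum⟩ := exists_loss hω α hα V hr0 hrn hrV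
  have hρη : η / ε * v = 2 * η / (1 + η) * ρ := by
    rw [hρ]
    field_simp
  -- It is enough to find one point with a small loss.
  suffices h : ∃ j < K, (loss j : ℝ) ≤ (1 - η) / (1 + η) * r by
    obtain ⟨j, hj, hjl⟩ := h
    have h1 : (r : ℝ) ≤ (Module.finrank F
        (⨆ l : Fin d, V.map (condenserBlock n ω (α j) l).mulVecLin :
          Submodule F (Fin n → F)) : ℝ) + loss j := by exact_mod_cast hloss j
    have h2 : Module.finrank F (⨆ l : Fin d, V.map (condenserBlock n ω (α j) l).mulVecLin :
        Submodule F (Fin n → F)) ≤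
        Module.finrank F (⨆ i, V.map (A i).mulVecLin : Submodule F (Fin n → F)) := by
      refine Submodule.finrank_mono (iSup_le fun l => ?_)
      obtain ⟨i, hi⟩ := hA j hj l l.2
      rw [← hi]
      exact le_iSup (fun i => V.map (A i).mulVecLin) i
    have h2' : (Module.finrank F (⨆ l : Fin d, V.map (condenserBlock n ω (α j) l).mulVecLin :
        Submodule F (Fin n → F)) : ℝ) ≤
        Module.finrank F (⨆ i, V.map (A i).mulVecLin : Submodule F (Fin n → F)) := by
      exact_mod_cast h2
    rw [hρη]
    calc 2 * η / (1 + η) * ρ ≤ 2 * η / (1 + η) * r :=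
          mul_le_mul_of_nonneg_left hρr (by positivity)
      _ = r - (1 - η) / (1 + η) * r := by field_simp; ring
      _ ≤ _ := by linarith
  by_contra! hall
  rcases hK with hKM | hK
  · have h1 : (M : ℝ) * ((1 - η) / (1 + η) * r) ≤ ∑ j ∈ Finset.range K, (loss j : ℝ) := by
      have := Finset.card_nsmul_le_sum (Finset.range K) (fun j => (loss j : ℝ))
        ((1 - η) / (1 + η) * r) fun j hj => (hall j (Finset.mem_range.1 hj)).le
      rwa [Finset.card_range, nsmul_eq_mul, congrArg Nat.cast hKM] at this
    have h2 : 2 * (1 + η) * (d : ℝ) / (1 - η) ^ 2 ≤ M := hM ▸ Nat.le_ceil _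
    have hη1 : 0 < 1 - η := by linarith
    have hr0' : (0 : ℝ) < r := by exact_mod_cast hr0
    have h3 : 2 * d * r / (1 - η) ≤ ∑ j ∈ Finset.range K, (loss j : ℝ) := by
      refine le_trans (le_of_eq ?_) ((mul_le_mul_of_nonneg_right h2 (by positivity)).trans h1)
      field_simp
    have h4 : (∑ j ∈ Finset.range K, (loss j : ℝ)) * (n - r + 1) ≤ r * (n * d - 1) := by
      have hnd : 1 ≤ n * d := Nat.mul_pos hn0' hd0
      have : (((∑ j ∈ Finset.range K, loss j) * (n - r + 1) : ℕ) : ℝ) ≤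
          ((r * (n * d - 1) : ℕ) : ℝ) := by exact_mod_cast hsum
      push_cast [Nat.cast_sub hrn, Nat.cast_sub hnd] at this
      exact this
    have h5 : (1 - η) / 2 * n ≤ n - r + 1 := by linarith
    have h6 : 2 * d * r / (1 - η) * ((1 - η) / 2 * n) ≤ r * (n * d - 1) :=
      (mul_le_mul h3 h5 (by positivity) (le_trans (by positivity) h3)).trans h4
    have h7 : 2 * d * r / (1 - η) * ((1 - η) / 2 * n) = r * (n * d) := by field_simp
    rw [h7] at h6
    linarith
  · have hpos : ∀ j ∈ Finset.range K, 1 ≤ loss j := by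
      intro j hj
      have h1 := hall j (Finset.mem_range.1 hj)
      have h2 : (0 : ℝ) < loss j := lt_of_le_of_lt
        (mul_nonneg (div_nonneg (by linarith) (by linarith)) (Nat.cast_nonneg r)) h1
      exact_mod_cast h2
    have h1 := Finset.card_nsmul_le_sum _ _ _ hpos
    rw [Finset.card_range, smul_eq_mul, mul_one] at h1
    have hnd : 1 ≤ n * d := Nat.mul_pos hn0' hd0
    have h2 : r * (n * d - 1) < n * (n * d) :=
      lt_of_le_of_lt (Nat.mul_le_mul_right _ hrn) (Nat.mul_lt_mul_of_pos_left (by omega) hn0')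
    have h3 : K ≤ r * (n * d - 1) :=
      (h1.trans (Nat.le_mul_of_pos_right _ (by omega))).trans hsum
    rw [← mul_assoc] at h2
    omega

theorem degree_le {ε η : ℝ} (hε : 0 < ε) (hη : η < 1) {d M : ℕ}
    (hd : d = ⌈(1 + η) / (2 * ε)⌉₊) (hM : M = ⌈2 * (1 + η) * (d : ℝ) / (1 - η) ^ 2⌉₊) :
    d * M ≤ ⌈1 / ε⌉₊ * ⌈4 * (⌈1 / ε⌉₊ : ℝ) / (1 - η) ^ 2⌉₊ := by
  have hd' : d ≤ ⌈1 / ε⌉₊ := by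
    rw [hd]
    refine Nat.ceil_mono ?_
    rw [div_le_div_iff₀ (by positivity) hε]
    nlinarith
  refine Nat.mul_le_mul hd' ?_
  rw [hM]
  refine Nat.ceil_mono ?_
  refine div_le_div_of_nonneg_right ?_ (by positivity)
  have h1 : (d : ℝ) ≤ ⌈1 / ε⌉₊ := by exact_mod_cast hd'
  exact mul_le_mul (by linarith) h1 (by positivity) (by norm_num)

theorem two_le_ceil {ε η : ℝ} (hε : 0 < ε) (hεη : ε ≤ η) (hη : η < 1) :
    2 ≤ ⌈(1 + η) / (2 * ε)⌉₊ := by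
  have : 1 < ⌈(1 + η) / (2 * ε)⌉₊ := by
    refine Nat.lt_ceil.2 ?_
    rw [Nat.cast_one, lt_div_iff₀ (by positivity)]
    linarith
  exact this

/-! ### The choice of the points -/

/-- The first term `e k` of the listing that avoids the set `S (e k)`; the junk value is `0`. -/
noncomputable def firstFresh (e : ℕ → F) (S : F → Set F) : F :=
  open Classical in if h : ∃ k, e k ∉ S (e k) then e (Nat.find h) else 0

/-- The powers `x ^ 2, …, x ^ (N + 1)`. If `N ≥ 1`, then they avoid `x` exactly when `x ≠ 0` and
`x ^ i ≠ 1` for `1 ≤ i ≤ N`. -/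
def highPowers (N : ℕ) (x : F) : Set F := {y | ∃ t < N, y = x * x * x ^ t}

/-- The ratio `ω`: the first listed element of order greater than `N`. -/
noncomputable def ratio (e : ℕ → F) (N : ℕ) : F := firstFresh e (highPowers N)

/-- The elements `x ω ^ i` with `|i| < n`. -/
def closeTo (ω : F) (n : ℕ) (x : F) : Set F :=
  {y | ∃ t < n, y = x * ω⁻¹ ^ t ∨ y = x * ω ^ t}

/-- The elements that are not available as point number `j`: zero, and everything close to a
point with smaller number. -/
noncomputable def forbidden (e : ℕ → F) (ω : F) (n : ℕ) : ℕ → Set F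
  | 0 => {0}
  | j + 1 => forbidden e ω n j ∪ closeTo ω n (firstFresh e fun _ => forbidden e ω n j)

/-- The evaluation points, chosen greedily along the listing. -/
noncomputable def point (e : ℕ → F) (ω : F) (n j : ℕ) : F :=
  firstFresh e fun _ => forbidden e ω n j

/-- A listing leaves every set of `m` elements within its first `m + 1` terms, provided the
field has more than `m` elements. -/
theorem exists_notMem_of_ncard_le {F : Type*} {e : ℕ → F} (he : IsListing e) {m : ℕ} {S : Set F}
    (hS : S.Finite) (hSm : S.ncard ≤ m) (hF : (m : ℕ∞) < ENat.card F) :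
    ∃ k ≤ m, e k ∉ S := by
  by_contra! h
  have hinj : Set.InjOn e (Set.Iic m) := he.mono fun k (hk : k ≤ m) =>
    lt_of_le_of_lt (by exact_mod_cast hk) hF
  have h1 : (e '' Set.Iic m).ncard = m + 1 := by
    rw [hinj.ncard_image, Set.ncard_eq_toFinset_card']
    simp
  have h2 : (e '' Set.Iic m).ncard ≤ S.ncard := by
    refine Set.ncard_le_ncard ?_ hS
    rintro _ ⟨k, hk, rfl⟩
    exact h k hk
  omega

theorem exists_notMem_highPowers {e : ℕ → F} (he : IsListing e) {N : ℕ} (hN : 2 ≤ N)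
    (hF : ((N * N : ℕ) : ℕ∞) < ENat.card F) : ∃ k ≤ N * N, e k ∉ highPowers N (e k) := by
  -- The bad candidates are roots of `X ∏ (X ^ i - 1)`.
  let Q : F[X] := X * ∏ i ∈ Finset.range N, (X ^ (i + 1) - C 1)
  have hmonic : ∀ i ∈ Finset.range N, (X ^ (i + 1) - C 1 : F[X]).Monic := fun i _ =>
    monic_X_pow_sub_C _ (by omega)
  have hQm : Q.Monic := monic_X.mul (monic_prod_of_monic _ _ hmonic)
  have hdeg : Q.natDegree = 1 + ∑ i ∈ Finset.range N, (i + 1) := by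
    rw [monic_X.natDegree_mul (monic_prod_of_monic _ _ hmonic), natDegree_X,
      natDegree_prod_of_monic _ _ hmonic]
    simp only [natDegree_X_pow_sub_C]
  have hsum : 1 + ∑ i ∈ Finset.range N, (i + 1) ≤ N * N := by
    clear hF hmonic hQm hdeg Q
    induction N, hN using Nat.le_induction with
    | base => decide
    | succ N hN ih =>
      rw [Finset.sum_range_succ]
      nlinarith
  classical
  obtain ⟨k, hk, hkQ⟩ := exists_notMem_of_ncard_le he (S := (Q.roots.toFinset : Set F))
    (Finset.finite_toSet _) (m := N * N) (by
      rw [Set.ncard_coe_finset]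
      exact (Multiset.toFinset_card_le _).trans ((card_roots' Q).trans (hdeg ▸ hsum))) hF
  refine ⟨k, hk, ?_⟩
  rintro ⟨t, ht, h⟩
  refine hkQ ?_
  simp only [Finset.mem_coe, Multiset.mem_toFinset, mem_roots hQm.ne_zero, IsRoot.def]
  rw [eval_mul, eval_X, eval_prod]
  by_cases h0 : e k = 0
  · rw [h0, zero_mul]
  · refine mul_eq_zero_of_right _ (Finset.prod_eq_zero (Finset.mem_range.2 ht) ?_)
    have : e k * 1 = e k * e k ^ (t + 1) := by
      rw [mul_one, pow_succ']
      rw [mul_assoc] at h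
      exact h
    simp [← mul_left_cancel₀ h0 this]

theorem firstFresh_eq {e : ℕ → F} {S : F → Set F} (h : ∃ k, e k ∉ S (e k)) :
    ∃ k, firstFresh e S = e k ∧ e k ∉ S (e k) ∧ ∀ j < k, e j ∈ S (e j) := by
  classical
  refine ⟨Nat.find h, ?_, Nat.find_spec h, fun j hj => not_not.1 (Nat.find_min h hj)⟩
  rw [firstFresh, dif_pos h]

theorem firstFresh_notMem {e : ℕ → F} {S : F → Set F} (h : ∃ k, e k ∉ S (e k)) :
    firstFresh e S ∉ S (firstFresh e S) := by
  obtain ⟨k, hk, hk', -⟩ := firstFresh_eq h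
  rwa [hk]

theorem ratio_ne_zero_and_injOn {e : ℕ → F} {N : ℕ} (hN : 2 ≤ N)
    (h : ∃ k, e k ∉ highPowers N (e k)) :
    ratio e N ≠ 0 ∧ Set.InjOn (fun k : ℕ => ratio e N ^ k) {k | k ≤ N} := by
  have hf := firstFresh_notMem h
  rw [← ratio] at hf
  set ω := ratio e N
  have h0 : ω ≠ 0 := by
    intro h0
    exact hf ⟨0, by omega, by simp [h0]⟩
  have hlt : ∀ a b, a < b → b ≤ N → ω ^ a ≠ ω ^ b := by
    intro a b hab hb heq
    obtain ⟨t, rfl⟩ := Nat.exists_eq_add_of_lt hab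
    refine hf ⟨t, by omega, ?_⟩
    have h1 : ω ^ a * 1 = ω ^ a * ω ^ (t + 1) := by
      rw [mul_one, ← pow_add, ← add_assoc]
      exact heq
    have h2 := mul_left_cancel₀ (pow_ne_zero a h0) h1
    rw [mul_assoc, ← pow_succ', ← h2, mul_one]
  refine ⟨h0, fun a ha b hb hab => ?_⟩
  rcases lt_trichotomy a b with h | h | h
  · exact (hlt a b h hb hab).elim
  · exact h
  · exact (hlt b a h ha hab.symm).elim

theorem forbidden_finite_ncard (e : ℕ → F) (ω : F) (n j : ℕ) :
    (forbidden e ω n j).Finite ∧ (forbidden e ω n j).ncard ≤ 1 + 2 * n * j := by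
  induction j with
  | zero => simp [forbidden]
  | succ j ih =>
    have hsub : ∀ x : F, closeTo ω n x ⊆
        (fun t => x * ω⁻¹ ^ t) '' Set.Iio n ∪ (fun t => x * ω ^ t) '' Set.Iio n := by
      rintro x y ⟨t, ht, rfl | rfl⟩
      · exact Or.inl ⟨t, ht, rfl⟩
      · exact Or.inr ⟨t, ht, rfl⟩
    have hc : ∀ g : ℕ → F, (g '' Set.Iio n).ncard ≤ n := fun g => by
      refine (Set.ncard_image_le (Set.finite_Iio n)).trans ?_
      rw [Set.ncard_eq_toFinset_card']
      simp
    have hfin : ∀ x : F, ((fun t => x * ω⁻¹ ^ t) '' Set.Iio n ∪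
        (fun t => x * ω ^ t) '' Set.Iio n).Finite := fun x =>
      ((Set.finite_Iio n).image _).union ((Set.finite_Iio n).image _)
    refine ⟨ih.1.union ((hfin _).subset (hsub _)), ?_⟩
    refine (Set.ncard_union_le _ _).trans ?_
    have h1 := (Set.ncard_le_ncard (hsub (firstFresh e fun _ => forbidden e ω n j))
      (hfin _)).trans ((Set.ncard_union_le _ _).trans (Nat.add_le_add (hc _) (hc _)))
    have h2 := ih.2
    rw [mul_add, mul_one]
    omega

theorem exists_notMem_forbidden {e : ℕ → F} (he : IsListing e) (ω : F) {n d j : ℕ} (hd : 2 ≤ d)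
    (hF : ((d ^ 2 * n ^ 3 : ℕ) : ℕ∞) < ENat.card F) (hj : j < n * n * d) :
    ∃ k ≤ d ^ 2 * n ^ 3, e k ∉ forbidden e ω n j := by
  obtain ⟨hfin, hcard⟩ := forbidden_finite_ncard e ω n j
  refine exists_notMem_of_ncard_le he hfin (hcard.trans ?_) hF
  have hn : 0 < n := Nat.pos_of_ne_zero (by rintro rfl; simp at hj)
  -- Up to `2 n³ d` elements may be forbidden, and `2 n³ d ≤ d² n³` because `2 ≤ d`.
  have h1 : 2 * n * (j + 1) ≤ 2 * n * (n * n * d) := Nat.mul_le_mul_left _ hj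
  have h2 : 2 * n * (n * n * d) ≤ d ^ 2 * n ^ 3 := by
    calc 2 * n * (n * n * d) = 2 * (d * n ^ 3) := by ring
      _ ≤ d * (d * n ^ 3) := Nat.mul_le_mul_right _ hd
      _ = _ := by ring
  rw [mul_add] at h1
  omega

theorem forbidden_mono (e : ℕ → F) (ω : F) (n : ℕ) : Monotone (forbidden e ω n) :=
  monotone_nat_of_le_succ fun _ => Set.subset_union_left

theorem injOn_pow_mul_point {e : ℕ → F} {ω : F} {n K : ℕ} (h0 : ω ≠ 0)
    (hω : Set.InjOn (fun k : ℕ => ω ^ k) {k | k < n})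
    (hfresh : ∀ j < K, ∃ k, e k ∉ forbidden e ω n j) :
    Set.InjOn (fun x : ℕ × ℕ => ω ^ x.2 * point e ω n x.1) {x | x.1 < K ∧ x.2 < n} := by
  have hp : ∀ j < K, point e ω n j ∉ forbidden e ω n j := fun j hj =>
    firstFresh_notMem (S := fun _ => forbidden e ω n j) (hfresh j hj)
  have hlt : ∀ i j, i < j → j < K → ∀ s < n, ∀ t < n,
      ω ^ s * point e ω n i ≠ ω ^ t * point e ω n j := by
    intro i j hij hj s hs t ht h
    refine hp j hj (forbidden_mono e ω n hij (Or.inr ?_))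
    change point e ω n j ∈ closeTo ω n (point e ω n i)
    rcases le_total s t with hst | hst
    · obtain ⟨u, rfl⟩ := Nat.exists_eq_add_of_le hst
      refine ⟨u, by omega, Or.inl ?_⟩
      rw [pow_add, mul_assoc] at h
      rw [mul_left_cancel₀ (pow_ne_zero s h0) h, mul_right_comm, ← mul_pow, mul_inv_cancel₀ h0,
        one_pow, one_mul]
    · obtain ⟨u, rfl⟩ := Nat.exists_eq_add_of_le hst
      refine ⟨u, by omega, Or.inr ?_⟩
      rw [pow_add, mul_assoc] at h
      rw [← mul_left_cancel₀ (pow_ne_zero t h0) h, mul_comm]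
  rintro ⟨i, s⟩ ⟨hi, hs⟩ ⟨j, t⟩ ⟨hj, ht⟩ h
  rcases lt_trichotomy i j with hij | rfl | hij
  · exact (hlt i j hij hj s hs t ht h).elim
  · have hne : point e ω n i ≠ 0 := by
      intro h'
      refine hp i hi (forbidden_mono e ω n (Nat.zero_le i) ?_)
      rw [h']
      rfl
    have := hω hs ht (mul_right_cancel₀ hne h)
    exact Prod.ext rfl this
  · exact (hlt j i hij hi t ht s hs h.symm).elim

/-- The matrices of the expander. Matrix number `i = j d + l` is block `l` at point `j`; the
zero matrix is used beyond the first `n² d` points, and throughout if `d > n`, when only the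
zero space has to be expanded. -/
noncomputable def expander (e : ℕ → F) (n d i : ℕ) : Matrix (Fin n) (Fin n) F :=
  if d ≤ n ∧ i < n * d * (n * d) then
    condenserBlock n (ratio e (n * d)) (point e (ratio e (n * d)) n (i / d)) (i % d)
  else 0

theorem isDimensionExpander_expander {e : ℕ → F} (he : IsListing e) {n d M : ℕ} {ε η : ℝ}
    (hε : 0 < ε) (hεη : ε ≤ η) (hη : η < 1)
    (hd : d = ⌈(1 + η) / (2 * ε)⌉₊) (hM : M = ⌈2 * (1 + η) * (d : ℝ) / (1 - η) ^ 2⌉₊)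
    (hF : ((d ^ 2 * n ^ 3 : ℕ) : ℕ∞) < ENat.card F) :
    IsDimensionExpander ε (η / ε) fun i : Fin (d * M) => expander e n d i := by
  have hd2 : 2 ≤ d := hd ▸ two_le_ceil hε hεη hη
  by_cases hdn : d ≤ n
  · have hn2 : 2 ≤ n := hd2.trans hdn
    have hN : 2 ≤ n * d := by nlinarith
    have hF' : ((n * d * (n * d) : ℕ) : ℕ∞) < ENat.card F := by
      refine lt_of_le_of_lt ?_ hF
      have : n * d * (n * d) * 1 ≤ n * d * (n * d) * n := Nat.mul_le_mul_left _ (by omega)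
      exact_mod_cast (by calc n * d * (n * d) ≤ n * d * (n * d) * n := by omega
                          _ = d ^ 2 * n ^ 3 := by ring)
    obtain ⟨k, -, hk⟩ := exists_notMem_highPowers he hN hF'
    obtain ⟨h0, hinj⟩ := ratio_ne_zero_and_injOn hN ⟨k, hk⟩
    refine isDimensionExpander_of_condenserBlock (K := min M (n * n * d)) hε hεη hη hd hM ?_
      (hinj.mono fun k (hk : k < n * d) => hk.le) (point e (ratio e (n * d)) n) ?_ _ ?_
    · rcases le_total M (n * n * d) with h | h
      · exact Or.inl (min_eq_left h)
      · exact Or.inr (min_eq_right h).ge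
    · refine injOn_pow_mul_point h0 (hinj.mono fun k (hk : k < n) => ?_) fun j hj => ?_
      · exact hk.le.trans (Nat.le_mul_of_pos_right n (by omega))
      · obtain ⟨k, -, hk⟩ := exists_notMem_forbidden he (ratio e (n * d)) hd2 hF
          (lt_of_lt_of_le hj (min_le_right _ _))
        exact ⟨k, hk⟩
    · intro j hj l hl
      have hlt : ∀ B, j < B → j * d + l < d * B := fun B hB => by
        have : d * (j + 1) ≤ d * B := Nat.mul_le_mul_left d hB
        rw [mul_add, mul_comm d j] at this
        omega
      refine ⟨⟨j * d + l, hlt M (lt_of_lt_of_le hj (min_le_left _ _))⟩, ?_⟩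
      have h1 := hlt _ (lt_of_lt_of_le hj (min_le_right _ _))
      have h2 : d * (n * n * d) = n * d * (n * d) := by ring
      have h3 : (j * d + l) / d = j := by
        rw [mul_comm, Nat.mul_add_div (by omega), Nat.div_eq_of_lt hl, add_zero]
      have h4 : (j * d + l) % d = l := by
        rw [mul_comm, Nat.mul_add_mod, Nat.mod_eq_of_lt hl]
      simp only [expander, h3, h4]
      rw [if_pos ⟨hdn, h2 ▸ h1⟩]
  · intro V hV
    have hv : Module.finrank F V = 0 := by
      by_contra h
      have h1 : (1 : ℝ) ≤ Module.finrank F V := by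
        exact_mod_cast Nat.one_le_iff_ne_zero.2 h
      exact hdn (hd ▸ ceil_div_two_mul_le_of_mul_ge_one hε hη (h1.trans hV))
    rw [hv]
    simp

end

/-! ### Total correctness with a time bound -/

/-- Started in `s`, the program `P` halts within `B` steps in a state satisfying `Q`. -/
def Runs (e : ℕ → F) (P : Prog) (s : State F) (B : ℕ) (Q : State F → Prop) : Prop :=
  ∃ T s', T ≤ B ∧ Exec e P s T s' ∧ Q s'

namespace Runs

variable {e : ℕ → F} {P P' : Prog} {s : State F} {B B' : ℕ} {Q Q' : State F → Prop}

theorem mono (h : Runs e P s B Q) (hB : B ≤ B') (hQ : ∀ s', Q s' → Q' s') : Runs e P s B' Q' := by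
  obtain ⟨T, s', hT, hE, hq⟩ := h
  exact ⟨T, s', hT.trans hB, hE, hQ _ hq⟩

theorem skip (h : Q s) : Runs e .skip s 0 Q := ⟨0, s, le_rfl, .skip s, h⟩

theorem seq (h : Runs e P s B Q) (h' : ∀ s', Q s' → Runs e P' s' B' Q') :
    Runs e (.seq P P') s (B + B') Q' := by
  obtain ⟨T, s', hT, hE, hq⟩ := h
  obtain ⟨T', s'', hT', hE', hq'⟩ := h' s' hq
  exact ⟨T + T', s'', Nat.add_le_add hT hT', .seq hE hE', hq'⟩

theorem ifNat {r : ℕ} (h : s.reg r = 0 → Runs e P s B Q) (h' : s.reg r ≠ 0 → Runs e P' s B Q) :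
    Runs e (.ifNat r P P') s (B + 1) Q := by
  by_cases hr : s.reg r = 0
  · obtain ⟨T, s', hT, hE, hq⟩ := h hr
    exact ⟨T + 1, s', Nat.add_le_add_right hT 1, .ifNat_zero hr hE, hq⟩
  · obtain ⟨T, s', hT, hE, hq⟩ := h' hr
    exact ⟨T + 1, s', Nat.add_le_add_right hT 1, .ifNat_ne hr hE, hq⟩

theorem ifField {r : ℕ} (h : s.get r = 0 → Runs e P s B Q)
    (h' : s.get r ≠ 0 → Runs e P' s B Q) : Runs e (.ifField r P P') s (B + 1) Q := by
  by_cases hr : s.get r = 0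
  · obtain ⟨T, s', hT, hE, hq⟩ := h hr
    exact ⟨T + 1, s', Nat.add_le_add_right hT 1, .ifField_zero hr hE, hq⟩
  · obtain ⟨T, s', hT, hE, hq⟩ := h' hr
    exact ⟨T + 1, s', Nat.add_le_add_right hT 1, .ifField_ne hr hE, hq⟩

/-- The loop rule: `I m` is the invariant at the loop head when `m` rounds remain. -/
theorem loop {r : ℕ} {I : ℕ → State F → Prop} (h0 : ∀ s, I 0 s → s.reg r = 0)
    (hs : ∀ m s, I (m + 1) s → s.reg r ≠ 0 ∧ Runs e P s B (I m)) :
    ∀ m s, I m s → Runs e (.loop r P) s (m * (B + 1) + 1) (I 0)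
  | 0, s, h => ⟨1, s, by omega, .loop_done (h0 s h), h⟩
  | m + 1, s, h => by
    obtain ⟨hr, T, s', hT, hE, hq⟩ := hs m s h
    obtain ⟨T', s'', hT', hE', hq'⟩ := loop h0 hs m s' hq
    refine ⟨T + T' + 1, s'', ?_, .loop_step hr hE hE', hq'⟩
    rw [Nat.succ_mul]
    omega

end Runs

/-- A sequence of elementary instructions. -/
def block : List Instr → Prog
  | [] => .skip
  | c :: l => .seq (.instr c) (block l)

theorem Runs.block {e : ℕ → F} {Q : State F → Prop} : ∀ {l : List Instr} {s : State F},
    Q (l.foldl (fun s c => c.apply e s) s) → Runs e (block l) s l.length Q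
  | [], _, h => .skip h
  | c :: l, s, h => by
    obtain ⟨T, s', hT, hE, hq⟩ := Runs.block (l := l) (s := c.apply e s) h
    exact ⟨1 + T, s', by rw [List.length_cons]; omega, .seq (.instr c s) hE, hq⟩

/-! ### The registers and the memory layout

A name `r…` stands for a register that holds a number, a name `p…` for one that holds the address of
a field element. -/

local notation "rDim" => (0 : ℕ)
local notation "rIndex" => (1 : ℕ)
local notation "rDeg" => (2 : ℕ)
local notation "rOne" => (4 : ℕ)
local notation "pOne" => (5 : ℕ)
local notation "pCur" => (6 : ℕ)
local notation "pX" => (7 : ℕ)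
local notation "pRatio" => (8 : ℕ)
local notation "pInv" => (9 : ℕ)
local notation "pTmp" => (10 : ℕ)
local notation "rBase" => (11 : ℕ)
local notation "rLen" => (12 : ℕ)
local notation "rZero" => (13 : ℕ)
local notation "rAddr" => (14 : ℕ)
local notation "rCnt" => (15 : ℕ)
local notation "rFlag" => (16 : ℕ)
local notation "rEnum" => (17 : ℕ)
local notation "rScan" => (18 : ℕ)
local notation "rCell" => (19 : ℕ)
local notation "rTest" => (20 : ℕ)
local notation "rShift" => (21 : ℕ)
local notation "rRow" => (22 : ℕ)
local notation "rRowCnt" => (23 : ℕ)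
local notation "rRest" => (24 : ℕ)

/-- The registers below `14` hold constants and pointers: the matrix occupies the first `n * n`
cells, six cells for single field elements follow (the constant `1`, the next term of a progression,
the current candidate or point, `ω`, `ω⁻¹`, and a difference to be tested), and a list of field
elements starts at `n * n + 6`. The list ends before the cell whose address is in `rAddr`. -/
structure Layout (n d : ℕ) (s : State F) : Prop where
  dim : s.reg rDim = n
  deg : s.reg rDeg = d
  one : s.reg rOne = 1
  ptrOne : s.reg pOne = n * n
  ptrCur : s.reg pCur = n * n + 1
  ptrX : s.reg pX = n * n + 2
  ptrRatio : s.reg pRatio = n * n + 3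
  ptrInv : s.reg pInv = n * n + 4
  ptrTmp : s.reg pTmp = n * n + 5
  base : s.reg rBase = n * n + 6
  len : s.reg rLen = n * d
  zero : s.reg rZero = 0
  memOne : s.mem (n * n) = 1

theorem Layout.congr {n d : ℕ} {s s' : State F} (h : Layout n d s)
    (hr : ∀ r < 14, s'.reg r = s.reg r) (hm : s'.mem (n * n) = s.mem (n * n)) :
    Layout n d s' where
  dim := (hr _ (by norm_num)).trans h.dim
  deg := (hr _ (by norm_num)).trans h.deg
  one := (hr _ (by norm_num)).trans h.one
  ptrOne := (hr _ (by norm_num)).trans h.ptrOne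
  ptrCur := (hr _ (by norm_num)).trans h.ptrCur
  ptrX := (hr _ (by norm_num)).trans h.ptrX
  ptrRatio := (hr _ (by norm_num)).trans h.ptrRatio
  ptrInv := (hr _ (by norm_num)).trans h.ptrInv
  ptrTmp := (hr _ (by norm_num)).trans h.ptrTmp
  base := (hr _ (by norm_num)).trans h.base
  len := (hr _ (by norm_num)).trans h.len
  zero := (hr _ (by norm_num)).trans h.zero
  memOne := hm.trans h.memOne

/-- The set of the field elements in the cells `a ≤ k < b`. -/
def cellSet (s : State F) (a b : ℕ) : Set F := {y | ∃ k, a ≤ k ∧ k < b ∧ s.mem k = y}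

theorem cellSet_congr {F : Type*} {s s' : State F} {a b : ℕ}
    (h : ∀ k, a ≤ k → k < b → s'.mem k = s.mem k) : cellSet s' a b = cellSet s a b := by
  ext y
  refine exists_congr fun k => and_congr_right fun h1 => and_congr_right fun h2 => ?_
  rw [h k h1 h2]

/-! ### Subroutines -/

/-- Multiplication of registers by repeated addition. -/
def mulReg (r a b : ℕ) : Prog :=
  .seq (block [.natConst r 0, .natAdd rTest b rZero])
    (.loop rTest (block [.natAdd r r a, .natSub rTest rTest rOne]))

theorem runs_mulReg {e : ℕ → F} {s : State F} {r a b : ℕ} (h1 : s.reg rOne = 1)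
    (h0 : s.reg rZero = 0) (hr : r ≠ rTest) (hr1 : r ≠ rOne) (hr0 : r ≠ rZero) (hra : r ≠ a)
    (hrb : r ≠ b) (ha : a ≠ rTest) :
    Runs e (mulReg r a b) s (3 * s.reg b + 3) fun s' =>
      s'.reg r = s.reg a * s.reg b ∧ (∀ q, q ≠ r → q ≠ rTest → s'.reg q = s.reg q) ∧
        s'.mem = s.mem := by
  let I : ℕ → State F → Prop := fun m s' => s'.reg rTest = m ∧
    s'.reg r + s.reg a * m = s.reg a * s.reg b ∧
    (∀ q, q ≠ r → q ≠ rTest → s'.reg q = s.reg q) ∧ s'.mem = s.mem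
  have hloop := Runs.loop (e := e) (r := rTest) (I := I) (B := 2)
    (P := block [.natAdd r r a, .natSub rTest rTest rOne]) (fun s h => h.1) (by
      rintro m s' ⟨ht, hv, hq, hm⟩
      refine ⟨by omega, Runs.block ⟨?_, ?_, ?_, ?_⟩⟩
      · simp (disch := omega) [Instr.apply, State.setReg, Function.update_of_ne, ht, hq, h1]
      · simp (disch := omega) [Instr.apply, State.setReg, Function.update_of_ne, hq]
        rw [mul_add, mul_one] at hv
        omega
      · intro q hq1 hq2
        simp [Instr.apply, State.setReg, hq1, hq2, hq]
      · simp [Instr.apply, State.setReg, hm])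
  refine ((Runs.block (Q := I (s.reg b)) ⟨?_, ?_, ?_, ?_⟩).seq
    (fun s' h => hloop _ s' h)).mono ?_ ?_
  · simp [Instr.apply, State.setReg, h0, hr0.symm, hrb.symm]
  · simp [Instr.apply, State.setReg, hr]
  · intro q hq1 hq2
    simp [Instr.apply, State.setReg, hq1, hq2]
  · simp [Instr.apply, State.setReg]
  · simp only [List.length_cons, List.length_nil]
    omega
  · rintro s' ⟨-, hv, hq, hm⟩
    exact ⟨by simpa using hv, hq, hm⟩

/-- Write a geometric progression of `rCnt` terms, starting at the cell `rAddr`, with first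
term at `pCur` and with the ratio that `rt` points to. The next term is left at `pCur`. -/
def geom (rt : ℕ) : Prog :=
  .loop rCnt (block [.fieldMul rAddr pCur pOne, .fieldMul pCur pCur rt,
    .natAdd rAddr rAddr rOne, .natSub rCnt rCnt rOne])

theorem runs_geom {e : ℕ → F} {n d : ℕ} {s : State F} (hL : Layout n d s) {rt p a c : ℕ}
    (hrt : rt < 14) (hp : s.reg rt = p) (hp1 : n * n + 1 < p) (hp2 : p < n * n + 6)
    (ha : s.reg rAddr = a) (hc : s.reg rCnt = c) (hac : a + c ≤ n * n ∨ n * n + 6 ≤ a) :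
    Runs e (geom rt) s (5 * c + 1) fun s' =>
      Layout n d s' ∧ (∀ r, r ≠ rAddr → r ≠ rCnt → s'.reg r = s.reg r) ∧
      s'.reg rAddr = a + c ∧
      (∀ t < c, s'.mem (a + t) = s.mem (n * n + 1) * s.mem p ^ t) ∧
      s'.mem (n * n + 1) = s.mem (n * n + 1) * s.mem p ^ c ∧
      ∀ k, k ≠ n * n + 1 → (k < a ∨ a + c ≤ k) → s'.mem k = s.mem k := by
  let I : ℕ → State F → Prop := fun m s' => ∃ t, m + t = c ∧
    (∀ r, r ≠ rAddr → r ≠ rCnt → s'.reg r = s.reg r) ∧ s'.reg rAddr = a + t ∧ s'.reg rCnt = m ∧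
    (∀ u < t, s'.mem (a + u) = s.mem (n * n + 1) * s.mem p ^ u) ∧
    s'.mem (n * n + 1) = s.mem (n * n + 1) * s.mem p ^ t ∧
    ∀ k, k ≠ n * n + 1 → (k < a ∨ a + t ≤ k) → s'.mem k = s.mem k
  have hloop := Runs.loop (e := e) (r := rCnt) (I := I) (B := 4)
    (P := block [.fieldMul rAddr pCur pOne, .fieldMul pCur pCur rt,
      .natAdd rAddr rAddr rOne, .natSub rCnt rCnt rOne])
    (fun s h => by obtain ⟨t, -, -, -, h, -⟩ := h; exact h) (by
      rintro m s' ⟨t, hmt, hreg, haddr, hcnt, hwr, hcur, hfr⟩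
      have e1 : s'.reg pCur = n * n + 1 := (hreg _ (by decide) (by decide)).trans hL.ptrCur
      have e2 : s'.reg pOne = n * n := (hreg _ (by decide) (by decide)).trans hL.ptrOne
      have e3 : s'.reg rOne = 1 := (hreg _ (by decide) (by decide)).trans hL.one
      have e4 : s'.reg rt = p := (hreg _ (by omega) (by omega)).trans hp
      have m1 : s'.mem (n * n) = 1 := (hfr _ (by omega) (by omega)).trans hL.memOne
      have mp : s'.mem p = s.mem p := hfr _ (by omega) (by omega)
      have n1 : n * n + 1 ≠ a + t := by omega
      have n2 : p ≠ a + t := by omega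
      refine ⟨by omega, Runs.block ⟨t + 1, by omega, ?_, ?_, ?_, ?_, ?_, ?_⟩⟩
      · intro r h1 h2
        simp [Instr.apply, State.setReg, State.setMem, h1, h2, hreg]
      · simp [Instr.apply, State.setReg, State.setMem, haddr, e3, add_assoc]
      · simp [Instr.apply, State.setReg, State.setMem, hcnt, e3]
      · intro u hu
        have n3 : a + u ≠ n * n + 1 := by omega
        rcases Nat.lt_succ_iff_lt_or_eq.1 hu with hu | rfl
        · simp [Instr.apply, State.setReg, State.setMem, State.get, e1, haddr, n3, hu.ne, hwr u hu]
        · simp [Instr.apply, State.setReg, State.setMem, State.get, e1, e2, haddr, n3, m1, hcur]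
      · simp [Instr.apply, State.setReg, State.setMem, State.get, e1, e4, haddr, n1, n2, hcur, mp,
          pow_succ, mul_assoc]
      · intro k h1 h2
        have n4 : k ≠ a + t := by omega
        simp [Instr.apply, State.setReg, State.setMem, State.get, e1, haddr, h1, n4]
        exact hfr k h1 (by omega))
  refine (hloop c s ⟨0, rfl, fun _ _ _ => rfl, ha, hc, ?_, ?_, fun _ _ _ => rfl⟩).mono
    (by omega) ?_
  · intro u hu
    omega
  · simp
  · rintro s' ⟨t, hmt, hreg, haddr, hcnt, hwr, hcur, hfr⟩
    obtain rfl : t = c := by omega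
    exact ⟨hL.congr (fun r hr => hreg r (by omega) (by omega)) (hfr _ (by omega) (by omega)),
      hreg, haddr, hwr, hcur, hfr⟩

/-- Set `rFlag` to `0` if the element at `pX` does not occur in the list from `rBase` up to
`rAddr`, and to `1` otherwise. -/
def scan : Prog :=
  .seq (block [.natConst rFlag 0, .natSub rScan rAddr rBase])
    (.loop rScan (.seq (block [.natAdd rCell rScan rBase, .natSub rCell rCell rOne,
        .fieldSub pTmp pX rCell, .natSub rScan rScan rOne])
      (.ifField pTmp (block [.natConst rFlag 1]) .skip)))

theorem runs_scan {e : ℕ → F} {n d : ℕ} {s : State F} (hL : Layout n d s) {len : ℕ}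
    (ha : s.reg rAddr = n * n + 6 + len) :
    Runs e scan s (7 * len + 3) fun s' =>
      (∀ r, r ≠ rFlag → r ≠ rScan → r ≠ rCell → s'.reg r = s.reg r) ∧
      (∀ k, k ≠ n * n + 5 → s'.mem k = s.mem k) ∧
      (s'.reg rFlag = 0 ↔ s.mem (n * n + 2) ∉ cellSet s (n * n + 6) (n * n + 6 + len)) := by
  let I : ℕ → State F → Prop := fun m s' => m ≤ len ∧ s'.reg rScan = m ∧
    (∀ r, r ≠ rFlag → r ≠ rScan → r ≠ rCell → s'.reg r = s.reg r) ∧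
    (∀ k, k ≠ n * n + 5 → s'.mem k = s.mem k) ∧
    (s'.reg rFlag = 0 ↔
      s.mem (n * n + 2) ∉ cellSet s (n * n + 6 + m) (n * n + 6 + len))
  have hloop := Runs.loop (e := e) (r := rScan) (I := I) (B := 6)
    (P := .seq (block [.natAdd rCell rScan rBase, .natSub rCell rCell rOne,
        .fieldSub pTmp pX rCell, .natSub rScan rScan rOne])
      (.ifField pTmp (block [.natConst rFlag 1]) .skip)) (fun s h => h.2.1) (by
      rintro m s' ⟨hm, hq, hreg, hmem, hfl⟩
      have e1 : s'.reg pX = n * n + 2 :=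
        (hreg _ (by decide) (by decide) (by decide)).trans hL.ptrX
      have e2 : s'.reg pTmp = n * n + 5 :=
        (hreg _ (by decide) (by decide) (by decide)).trans hL.ptrTmp
      have e3 : s'.reg rOne = 1 := (hreg _ (by decide) (by decide) (by decide)).trans hL.one
      have e4 : s'.reg rBase = n * n + 6 :=
        (hreg _ (by decide) (by decide) (by decide)).trans hL.base
      have e5 : m + 1 + (n * n + 6) - 1 = n * n + 6 + m := by omega
      have mx : s'.mem (n * n + 2) = s.mem (n * n + 2) := hmem _ (by omega)
      have mc : s'.mem (n * n + 6 + m) = s.mem (n * n + 6 + m) := hmem _ (by omega)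
      have hset : s.mem (n * n + 2) ∉ cellSet s (n * n + 6 + m) (n * n + 6 + len) ↔
          s.mem (n * n + 6 + m) ≠ s.mem (n * n + 2) ∧
            s.mem (n * n + 2) ∉ cellSet s (n * n + 6 + (m + 1)) (n * n + 6 + len) := by
        constructor
        · intro h
          refine ⟨fun h' => h ⟨_, le_rfl, by omega, h'⟩, ?_⟩
          rintro ⟨k, h1, h2, h3⟩
          exact h ⟨k, by omega, h2, h3⟩
        · rintro ⟨h1, h2⟩ ⟨k, h3, h4, h5⟩
          rcases eq_or_lt_of_le h3 with rfl | h3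
          · exact h1 h5
          · exact h2 ⟨k, by omega, h4, h5⟩
      refine ⟨by omega, (Runs.seq (B := 4) (B' := 2) (Q := fun s'' =>
        s''.reg rScan = m ∧ s''.reg rFlag = s'.reg rFlag ∧
        (∀ r, r ≠ rFlag → r ≠ rScan → r ≠ rCell → s''.reg r = s.reg r) ∧
        (∀ k, k ≠ n * n + 5 → s''.mem k = s.mem k) ∧
        s''.get pTmp = s.mem (n * n + 2) - s.mem (n * n + 6 + m))
        (Runs.block ⟨?_, ?_, ?_, ?_, ?_⟩) ?_)⟩
      · simp [Instr.apply, State.setReg, State.setMem, hq, e3]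
      · simp [Instr.apply, State.setReg, State.setMem]
      · intro r h1 h2 h3
        simp [Instr.apply, State.setReg, State.setMem, h2, h3, hreg r h1 h2 h3]
      · intro k hk
        simp [Instr.apply, State.setReg, State.setMem, e2, hk, hmem k hk]
      · simp [Instr.apply, State.setReg, State.setMem, State.get, e1, e2, e3, e4, hq, e5, mx, mc]
      · rintro s'' ⟨f1, f2, f3, f4, f5⟩
        refine Runs.ifField (B := 1) (fun h0 => ?_) (fun h0 => ?_)
        · rw [f5, sub_eq_zero] at h0
          refine Runs.block ⟨by omega, ?_, ?_, ?_, ?_⟩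
          · simp [Instr.apply, State.setReg, f1]
          · intro r h1 h2 h3
            simp [Instr.apply, State.setReg, h1, f3 r h1 h2 h3]
          · intro k hk
            simp [Instr.apply, State.setReg, f4 k hk]
          · rw [hset]
            simp [Instr.apply, State.setReg, h0]
        · rw [f5, sub_ne_zero] at h0
          refine (Runs.skip ⟨by omega, f1, f3, f4, ?_⟩).mono (by omega) fun _ h => h
          rw [hset, f2, hfl]
          exact ⟨fun h => ⟨h0.symm, h⟩, fun h => h.2⟩)
  refine ((Runs.block (Q := I len) ⟨le_rfl, ?_, ?_, ?_, ?_⟩).seq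
    (fun s' h => hloop _ s' h)).mono ?_ ?_
  · simp [Instr.apply, State.setReg, ha, hL.base]
  · intro r h1 h2 h3
    simp [Instr.apply, State.setReg, h1, h2]
  · intro k hk
    simp [Instr.apply, State.setReg]
  · simp only [List.foldl, Instr.apply, State.setReg]
    refine iff_of_true (by simp) ?_
    rintro ⟨k, h1, h2, -⟩
    omega
  · simp only [List.length_cons, List.length_nil]
    omega
  · rintro s' ⟨-, -, h1, h2, h3⟩
    exact ⟨h1, h2, h3⟩

/-- Search the listing for the first element that does not occur in the list that `build` makes
for it. -/
def find (build : Prog) : Prog :=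
  .seq (block [.natConst rEnum 0, .natConst rFlag 1])
    (.loop rFlag (.seq (block [.fieldEnum pX rEnum, .natAdd rEnum rEnum rOne])
      (.seq build scan)))

/-- The search ends at the first index `k₀` with `e k₀ ∉ S (e k₀)`, where `S x` is the content of
the list that `build` makes for the candidate `x`. The invariant `Inv` may not depend on the
registers and cells that the search itself uses. -/
theorem runs_find {e : ℕ → F} {n d : ℕ} {build : Prog} {S : F → Set F} {k₀ L T : ℕ}
    (hfresh : e k₀ ∉ S (e k₀)) (hmin : ∀ k < k₀, e k ∈ S (e k)) {Inv : State F → Prop}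
    (hlay : ∀ s, Inv s → Layout n d s)
    (hinv : ∀ s s' : State F, Inv s →
      (∀ r, r ≠ rFlag → r ≠ rEnum → r ≠ rScan → r ≠ rCell → s'.reg r = s.reg r) →
      (∀ k, k ≠ n * n + 2 → k ≠ n * n + 5 → s'.mem k = s.mem k) → Inv s')
    (hbuild : ∀ s, Inv s → Runs e build s T fun s' => Inv s' ∧ s'.reg rEnum = s.reg rEnum ∧
      s'.mem (n * n + 2) = s.mem (n * n + 2) ∧ ∃ len ≤ L, s'.reg rAddr = n * n + 6 + len ∧
      cellSet s' (n * n + 6) (n * n + 6 + len) = S (s.mem (n * n + 2)))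
    {s : State F} (hs : Inv s) :
    Runs e (find build) s ((k₀ + 1) * (T + 7 * L + 6) + 3) fun s' =>
      Inv s' ∧ s'.mem (n * n + 2) = e k₀ := by
  -- The number of rounds that remain is `k₀ + 1` minus the number of candidates tried.
  let I : ℕ → State F → Prop := fun m s' => Inv s' ∧
    (m = 0 → s'.reg rFlag = 0 ∧ s'.mem (n * n + 2) = e k₀) ∧
    (m ≠ 0 → s'.reg rFlag ≠ 0 ∧ s'.reg rEnum + m = k₀ + 1)
  have hloop := Runs.loop (e := e) (r := rFlag) (I := I) (B := 2 + (T + (7 * L + 3)))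
    (P := .seq (block [.fieldEnum pX rEnum, .natAdd rEnum rEnum rOne])
      (.seq build scan)) (fun s h => (h.2.1 rfl).1) (by
      rintro m s₁ ⟨i1, -, i3⟩
      obtain ⟨i3, i4⟩ := i3 (by omega)
      have l1 := hlay _ i1
      refine ⟨i3, ?_⟩
      refine Runs.seq (B := 2) (Q := fun s₂ => Inv s₂ ∧ s₂.reg rEnum = s₁.reg rEnum + 1 ∧
        s₂.mem (n * n + 2) = e (s₁.reg rEnum)) (Runs.block ⟨hinv s₁ _ i1 ?_ ?_, ?_, ?_⟩) ?_
      · intro r h1 h2 h3 h4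
        simp [Instr.apply, State.setReg, State.setMem, h2]
      · intro k h1 h2
        simp [Instr.apply, State.setReg, State.setMem, l1.ptrX, h1]
      · simp [Instr.apply, State.setReg, State.setMem, l1.one]
      · simp [Instr.apply, State.setReg, State.setMem, l1.ptrX]
      rintro s₂ ⟨j1, j2, j3⟩
      refine (hbuild s₂ j1).seq ?_
      rintro s₃ ⟨b1, b2, b3, len, b4, b5, b6⟩
      refine (runs_scan (hlay _ b1) b5).mono (by omega) ?_
      rintro s₄ ⟨c1, c2, c3⟩
      rw [b6, b3, j3] at c3
      have henum : s₄.reg rEnum = s₁.reg rEnum + 1 := by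
        rw [c1 _ (by decide) (by decide) (by decide), b2, j2]
      refine ⟨hinv s₃ s₄ b1 (fun r h1 _ h3 h4 => c1 r h1 h3 h4) fun k _ h2 => c2 k h2, ?_, ?_⟩
      · rintro rfl
        have hk : s₁.reg rEnum = k₀ := by omega
        rw [hk] at c3 j3
        exact ⟨c3.2 hfresh, by rw [c2 _ (by omega), b3, j3]⟩
      · intro hm
        refine ⟨fun h => c3.1 h (hmin _ (by omega)), by omega⟩)
  refine ((Runs.block (Q := I (k₀ + 1)) ⟨hinv s _ hs ?_ ?_, ?_, ?_⟩).seq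
    (fun s' h => hloop _ s' h)).mono ?_ ?_
  · intro r h1 h2 h3 h4
    simp [Instr.apply, State.setReg, h1, h2]
  · intro k h1 h2
    simp [Instr.apply, State.setReg]
  · omega
  · intro _
    simp [Instr.apply, State.setReg]
  · simp only [List.length_cons, List.length_nil]
    have : 2 + (T + (7 * L + 3)) + 1 = T + 7 * L + 6 := by omega
    rw [this]
    omega
  · rintro s' ⟨h1, h2, -⟩
    exact ⟨h1, (h2 rfl).2⟩

/-! ### The program -/

/-- Make the list of the powers `x ^ 2, …, x ^ (N + 1)` of the element `x` at `pX`. -/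
def buildPowers : Prog :=
  .seq (block [.natAdd rAddr rBase rZero, .natAdd rCnt rLen rZero, .fieldMul pCur pX pX])
    (geom pX)

theorem runs_buildPowers {e : ℕ → F} {n d : ℕ} {s : State F} (hL : Layout n d s) :
    Runs e buildPowers s (5 * (n * d) + 4) fun s' => Layout n d s' ∧
      (∀ r, r ≠ rAddr → r ≠ rCnt → s'.reg r = s.reg r) ∧
      s'.mem (n * n + 2) = s.mem (n * n + 2) ∧ s'.reg rAddr = n * n + 6 + n * d ∧
      cellSet s' (n * n + 6) (n * n + 6 + n * d) = highPowers (n * d) (s.mem (n * n + 2)) := by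
  refine (Runs.seq (Runs.block (Q := fun s' => Layout n d s' ∧
    (∀ r, r ≠ rAddr → r ≠ rCnt → s'.reg r = s.reg r) ∧ s'.reg rAddr = n * n + 6 ∧
    s'.reg rCnt = n * d ∧ s'.mem (n * n + 2) = s.mem (n * n + 2) ∧
    s'.mem (n * n + 1) = s.mem (n * n + 2) * s.mem (n * n + 2))
      ⟨hL.congr ?_ ?_, ?_, ?_, ?_, ?_, ?_⟩)
    (B' := 5 * (n * d) + 1) ?_).mono ?_ fun _ h => h
  · intro r hr
    simp (disch := omega) [Instr.apply, State.setReg, State.setMem, Function.update_of_ne]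
  · simp [Instr.apply, State.setReg, State.setMem, hL.ptrCur]
  · intro r h1 h2
    simp [Instr.apply, State.setReg, State.setMem, h1, h2]
  · simp [Instr.apply, State.setReg, State.setMem, hL.base, hL.zero]
  · simp [Instr.apply, State.setReg, State.setMem, hL.len, hL.zero]
  · simp [Instr.apply, State.setReg, State.setMem, hL.ptrCur]
  · simp [Instr.apply, State.setReg, State.setMem, State.get, hL.ptrCur, hL.ptrX]
  · rintro s₁ ⟨l1, hreg, haddr, hcnt, hx, hcur⟩
    refine (runs_geom l1 (by decide) l1.ptrX (by omega) (by omega) haddr hcnt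
      (Or.inr le_rfl)).mono le_rfl ?_
    rintro s₂ ⟨l2, hreg2, haddr2, hwr, -, hfr⟩
    refine ⟨l2, fun r h1 h2 => (hreg2 r h1 h2).trans (hreg r h1 h2),
      (hfr _ (by omega) (by omega)).trans hx, haddr2, ?_⟩
    rw [hcur, hx] at hwr
    ext y
    constructor
    · rintro ⟨k, h1, h2, rfl⟩
      obtain ⟨t, rfl⟩ := Nat.exists_eq_add_of_le h1
      exact ⟨t, by omega, hwr t (by omega)⟩
    · rintro ⟨t, ht, rfl⟩
      exact ⟨_, by omega, by omega, hwr t ht⟩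
  · simp only [List.length_cons, List.length_nil]
    omega

/-- Append the elements close to the element at `pX` to the list. -/
def appendClose : Prog :=
  .seq (block [.fieldMul pCur pX pOne, .natAdd rCnt rDim rZero]) <| .seq (geom pInv) <|
  .seq (block [.fieldMul pCur pX pOne, .natAdd rCnt rDim rZero]) (geom pRatio)

/-- One half of `appendClose`: the elements `x ρ ^ t` with `t < n` are appended to the list, where
`x` stands at `pX`, and `rt` points to `ρ`. -/
theorem runs_append {e : ℕ → F} {n d rt p len : ℕ} {s : State F} (hL : Layout n d s)
    (hrt : rt < 14) (hp : s.reg rt = p) (hp1 : n * n + 1 < p) (hp2 : p < n * n + 6)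
    (ha : s.reg rAddr = n * n + 6 + len) :
    Runs e (.seq (block [.fieldMul pCur pX pOne, .natAdd rCnt rDim rZero]) (geom rt)) s
      (5 * n + 3) fun s' => Layout n d s' ∧
      (∀ r, r ≠ rAddr → r ≠ rCnt → s'.reg r = s.reg r) ∧
      (∀ k, n * n + 1 < k → k < n * n + 6 → s'.mem k = s.mem k) ∧
      s'.reg rAddr = n * n + 6 + (len + n) ∧
      cellSet s' (n * n + 6) (n * n + 6 + (len + n)) =
        cellSet s (n * n + 6) (n * n + 6 + len) ∪
          {y | ∃ t < n, y = s.mem (n * n + 2) * s.mem p ^ t} := by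
  refine (Runs.seq (Runs.block (Q := fun s' => Layout n d s' ∧
    (∀ r, r ≠ rCnt → s'.reg r = s.reg r) ∧ s'.reg rCnt = n ∧
    (∀ k, k ≠ n * n + 1 → s'.mem k = s.mem k) ∧
    s'.mem (n * n + 1) = s.mem (n * n + 2)) ⟨hL.congr ?_ ?_, ?_, ?_, ?_, ?_⟩)
    (B' := 5 * n + 1) ?_).mono ?_ fun _ h => h
  · intro r hr
    simp (disch := omega) [Instr.apply, State.setReg, State.setMem, Function.update_of_ne]
  · simp [Instr.apply, State.setReg, State.setMem, hL.ptrCur]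
  · intro r h1
    simp [Instr.apply, State.setReg, State.setMem, h1]
  · simp [Instr.apply, State.setReg, State.setMem, hL.dim, hL.zero]
  · intro k hk
    simp [Instr.apply, State.setReg, State.setMem, hL.ptrCur, hk]
  · simp [Instr.apply, State.setReg, State.setMem, State.get, hL.ptrCur, hL.ptrX, hL.ptrOne,
      hL.memOne]
  · rintro s₁ ⟨l1, hreg, hcnt, hmem, hcur⟩
    refine (runs_geom l1 hrt ((hreg rt (by omega)).trans hp) hp1 hp2
      ((hreg _ (by decide)).trans ha) hcnt (Or.inr (by omega))).mono le_rfl ?_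
    rintro s₂ ⟨l2, hreg2, haddr2, hwr, -, hfr⟩
    refine ⟨l2, fun r h1 h2 => (hreg2 r h1 h2).trans (hreg r h2),
      fun k h1 h2 => (hfr k (by omega) (by omega)).trans (hmem k (by omega)),
      by rw [haddr2, add_assoc], ?_⟩
    rw [hcur, hmem p (by omega)] at hwr
    have hold : ∀ k, n * n + 6 ≤ k → k < n * n + 6 + len → s₂.mem k = s.mem k := fun k h1 h2 =>
      (hfr k (by omega) (by omega)).trans (hmem k (by omega))
    ext y
    constructor
    · rintro ⟨k, h1, h2, rfl⟩
      rcases lt_or_ge k (n * n + 6 + len) with h | h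
      · exact Or.inl ⟨k, h1, h, (hold k h1 h).symm⟩
      · obtain ⟨t, rfl⟩ := Nat.exists_eq_add_of_le h
        exact Or.inr ⟨t, by omega, hwr t (by omega)⟩
    · rintro (⟨k, h1, h2, rfl⟩ | ⟨t, ht, rfl⟩)
      · exact ⟨k, h1, by omega, hold k h1 h2⟩
      · exact ⟨_, by omega, by omega, hwr t ht⟩
  · simp only [List.length_cons, List.length_nil]
    omega

theorem Runs.seq_assoc {e : ℕ → F} {P₁ P₂ P₃ : Prog} {s : State F} {B : ℕ} {Q : State F → Prop}
    (h : Runs e (.seq (.seq P₁ P₂) P₃) s B Q) : Runs e (.seq P₁ (.seq P₂ P₃)) s B Q := by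
  obtain ⟨T, s', hT, hE, hq⟩ := h
  cases hE with
  | seq h12 h3 =>
    cases h12 with
    | seq h1 h2 => exact ⟨_, s', by omega, .seq h1 (.seq h2 h3), hq⟩

theorem runs_appendClose {e : ℕ → F} {n d len : ℕ} {ω : F} {s : State F} (hL : Layout n d s)
    (hω : s.mem (n * n + 3) = ω) (hω' : s.mem (n * n + 4) = ω⁻¹)
    (ha : s.reg rAddr = n * n + 6 + len) :
    Runs e appendClose s (10 * n + 6) fun s' => Layout n d s' ∧
      (∀ r, r ≠ rAddr → r ≠ rCnt → s'.reg r = s.reg r) ∧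
      (∀ k, n * n + 1 < k → k < n * n + 6 → s'.mem k = s.mem k) ∧
      s'.reg rAddr = n * n + 6 + (len + 2 * n) ∧
      cellSet s' (n * n + 6) (n * n + 6 + (len + 2 * n)) =
        cellSet s (n * n + 6) (n * n + 6 + len) ∪ closeTo ω n (s.mem (n * n + 2)) := by
  refine (Runs.seq_assoc ((runs_append hL (by decide) hL.ptrInv (by omega) (by omega) ha).seq
    (B' := 5 * n + 3) ?_)).mono (by omega) fun _ h => h
  rintro s₁ ⟨l1, r1, m1, a1, c1⟩
  refine (runs_append l1 (by decide) l1.ptrRatio (by omega) (by omega) a1).mono le_rfl ?_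
  rintro s₂ ⟨l2, r2, m2, a2, c2⟩
  have hlen : len + n + n = len + 2 * n := by omega
  rw [hlen] at a2 c2
  refine ⟨l2, fun r h1 h2 => (r2 r h1 h2).trans (r1 r h1 h2),
    fun k h1 h2 => (m2 k h1 h2).trans (m1 k h1 h2), a2, ?_⟩
  rw [c2, c1, Set.union_assoc, m1 _ (by omega) (by omega), m1 _ (by omega) (by omega), hω, hω']
  congr 1
  ext y
  constructor
  · rintro (⟨t, ht, h⟩ | ⟨t, ht, h⟩)
    · exact ⟨t, ht, Or.inl h⟩
    · exact ⟨t, ht, Or.inr h⟩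
  · rintro ⟨t, ht, h | h⟩
    · exact Or.inl ⟨t, ht, h⟩
    · exact Or.inr ⟨t, ht, h⟩

/-- The state of the search for the points before point number `j` is chosen: the list holds
the elements that are forbidden for it. -/
structure PointState (e : ℕ → F) (ω : F) (n d i j : ℕ) (s : State F) : Prop where
  layout : Layout n d s
  ratio : s.mem (n * n + 3) = ω
  inv : s.mem (n * n + 4) = ω⁻¹
  addr : s.reg rAddr = n * n + 6 + (1 + 2 * n * j)
  list : cellSet s (n * n + 6) (n * n + 6 + (1 + 2 * n * j)) = forbidden e ω n j
  rest : s.reg rRest + d * j = i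

theorem PointState.congr {e : ℕ → F} {ω : F} {n d i j : ℕ} {s s' : State F}
    (h : PointState e ω n d i j s) (hr : ∀ r < 14, s'.reg r = s.reg r)
    (ha : s'.reg rAddr = s.reg rAddr) (hi : s'.reg rRest = s.reg rRest)
    (hm : ∀ k, k ≠ n * n + 2 → k ≠ n * n + 5 → s'.mem k = s.mem k) :
    PointState e ω n d i j s' where
  layout := h.layout.congr hr (hm _ (by omega) (by omega))
  ratio := (hm _ (by omega) (by omega)).trans h.ratio
  inv := (hm _ (by omega) (by omega)).trans h.inv
  addr := ha.trans h.addr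
  list := by
    rw [cellSet_congr fun k h1 h2 => hm k (by omega) (by omega)]
    exact h.list
  rest := by rw [hi, h.rest]

theorem runs_find_skip {e : ℕ → F} {ω : F} {n d i j K : ℕ} {s : State F}
    (hK : ∃ k ≤ K, e k ∉ forbidden e ω n j) (hs : PointState e ω n d i j s) :
    Runs e (find .skip) s ((K + 1) * (7 * (1 + 2 * n * j) + 6) + 3) fun s' =>
      PointState e ω n d i j s' ∧ s'.mem (n * n + 2) = point e ω n j := by
  obtain ⟨k, hkK, hk⟩ := hK
  obtain ⟨k₀, h1, h2, h3⟩ := firstFresh_eq (S := fun _ => forbidden e ω n j) ⟨k, hk⟩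
  have hk₀ : k₀ ≤ K := le_trans (not_lt.1 fun h => hk (h3 k h)) hkK
  refine (runs_find (T := 0) (L := 1 + 2 * n * j) (S := fun _ => forbidden e ω n j) h2 h3
    (fun s h => h.layout) ?_ ?_ hs).mono ?_ ?_
  · intro s s' h hr hm
    exact h.congr (fun r hr' => hr r (by omega) (by omega) (by omega) (by omega))
      (hr _ (by decide) (by decide) (by decide) (by decide))
      (hr _ (by decide) (by decide) (by decide) (by decide)) hm
  · intro s h
    exact Runs.skip ⟨h, rfl, rfl, _, le_rfl, h.addr, h.list⟩
  · rw [zero_add]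
    exact Nat.add_le_add_right (Nat.mul_le_mul_right _ (by omega)) 3
  · rintro s' ⟨h4, h5⟩
    exact ⟨h4, h5.trans h1.symm⟩

/-- Choose the points up to number `i / d`, and replace `i` by `i % d`. -/
def choosePoints : Prog :=
  .seq (find .skip) <| .seq (block [.natAdd rTest rRest rOne, .natSub rTest rTest rDeg]) <|
    .loop rTest <| .seq appendClose <| .seq (find .skip) <|
      block [.natSub rRest rRest rDeg, .natAdd rTest rRest rOne, .natSub rTest rTest rDeg]

theorem runs_choosePoints {e : ℕ → F} {ω : F} {n d i K J : ℕ} {s : State F} (hd : 0 < d)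
    (hJ : i / d ≤ J) (hK : ∀ j ≤ i / d, ∃ k ≤ K, e k ∉ forbidden e ω n j)
    (hs : PointState e ω n d i 0 s) :
    Runs e choosePoints s
      ((J + 1) * (10 * n + 13 + ((K + 1) * (7 * (1 + 2 * n * J) + 6) + 3))) fun s' =>
      PointState e ω n d i (i / d) s' ∧ s'.mem (n * n + 2) = point e ω n (i / d) := by
  let G := (K + 1) * (7 * (1 + 2 * n * J) + 6) + 3
  have hG : ∀ j ≤ i / d, (K + 1) * (7 * (1 + 2 * n * j) + 6) + 3 ≤ G := fun j hj => by
    have : 2 * n * j ≤ 2 * n * J := Nat.mul_le_mul_left _ (hj.trans hJ)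
    exact Nat.add_le_add_right (Nat.mul_le_mul_left _ (by omega)) 3
  let I : ℕ → State F → Prop := fun m s' => ∃ j, m + j = i / d ∧ PointState e ω n d i j s' ∧
    s'.mem (n * n + 2) = point e ω n j ∧ s'.reg rTest = s'.reg rRest + 1 - d
  have hdiv : d * (i / d) + i % d = i := Nat.div_add_mod i d
  have hmod : i % d < d := Nat.mod_lt i hd
  have hloop := Runs.loop (e := e) (r := rTest) (I := I) (B := 10 * n + 6 + (G + 3))
    (P := .seq appendClose <| .seq (find .skip) <|
      block [.natSub rRest rRest rDeg, .natAdd rTest rRest rOne, .natSub rTest rTest rDeg])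
    (by
      rintro s' ⟨j, hj, hps, -, ht⟩
      have h1 := hps.rest
      rw [zero_add] at hj
      subst hj
      omega) (by
      rintro m s₁ ⟨j, hj, hps, hx, ht⟩
      have hrest := hps.rest
      have hmul : d * (m + 1 + j) = d * m + d + d * j := by ring
      rw [← hj, hmul] at hdiv
      refine ⟨by omega, ?_⟩
      refine (runs_appendClose hps.layout hps.ratio hps.inv hps.addr).seq ?_
      rintro s₂ ⟨l2, r2, m2, a2, c2⟩
      have hlen : 1 + 2 * n * j + 2 * n = 1 + 2 * n * (j + 1) := by ring
      rw [hlen] at a2 c2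
      -- The remainder register is still to be decreased, hence `i + d` in place of `i`.
      have hps2 : PointState e ω n d (i + d) (j + 1) s₂ := by
        refine ⟨l2, (m2 _ (by omega) (by omega)).trans hps.ratio,
          (m2 _ (by omega) (by omega)).trans hps.inv, a2, ?_, ?_⟩
        · rw [c2, hps.list, hx]
          rfl
        · rw [r2 _ (by decide) (by decide), mul_add]
          omega
      refine Runs.seq ((runs_find_skip (hK (j + 1) (by omega)) hps2).mono
        (hG (j + 1) (by omega)) fun _ h => h) ?_
      rintro s₃ ⟨hps3, hx3⟩
      have hrest3 := hps3.rest
      rw [mul_add, mul_one] at hrest3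
      refine Runs.block ⟨j + 1, by omega, ⟨hps3.layout.congr ?_ ?_, ?_, ?_, ?_, ?_, ?_⟩, ?_, ?_⟩
      · intro r hr
        simp (disch := omega) [Instr.apply, State.setReg, Function.update_of_ne]
      · simp [Instr.apply, State.setReg]
      · simpa [Instr.apply, State.setReg] using hps3.ratio
      · simpa [Instr.apply, State.setReg] using hps3.inv
      · simpa [Instr.apply, State.setReg] using hps3.addr
      · exact hps3.list
      · simp [Instr.apply, State.setReg, hps3.layout.deg, mul_add]
        omega
      · simpa [Instr.apply, State.setReg] using hx3
      · simp [Instr.apply, State.setReg, hps3.layout.deg, hps3.layout.one])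
  refine (Runs.seq ((runs_find_skip (hK 0 (Nat.zero_le _)) hs).mono (hG 0 (Nat.zero_le _))
    fun _ h => h) (B' := 2 + (i / d * (10 * n + 6 + (G + 3) + 1) + 1)) ?_).mono ?_
      fun _ h => h
  · rintro s₁ ⟨hps, hx⟩
    refine Runs.seq (B := 2) (Runs.block (Q := I (i / d)) ⟨0, rfl, hps.congr ?_ ?_ ?_ ?_, ?_, ?_⟩)
      fun s₂ h2 => (hloop _ s₂ h2).mono le_rfl ?_
    · intro r hr
      simp (disch := omega) [Instr.apply, State.setReg, Function.update_of_ne]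
    · simp [Instr.apply, State.setReg]
    · simp [Instr.apply, State.setReg]
    · intro k _ _
      simp [Instr.apply, State.setReg]
    · simpa [Instr.apply, State.setReg] using hx
    · simp [Instr.apply, State.setReg, hps.layout.deg, hps.layout.one]
    · rintro s₃ ⟨j, hj, h3, h4, -⟩
      rw [zero_add] at hj
      subst hj
      exact ⟨h3, h4⟩
  · calc G + (2 + (i / d * (10 * n + 6 + (G + 3) + 1) + 1))
        ≤ (i / d + 1) * (10 * n + 13 + G) := by
          have : i / d * (10 * n + 6 + (G + 3) + 1) ≤ i / d * (10 * n + 13 + G) :=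
            Nat.mul_le_mul_left _ (by omega)
          rw [Nat.add_one_mul (i / d)]
          omega
      _ ≤ (J + 1) * (10 * n + 13 + G) := Nat.mul_le_mul_right _ (by omega)

/-- Write the matrix, row by row; row number `a` is a segment of the progression of the powers of
`ω ^ a α`, which stands at `pX`. -/
def writeRows : Prog :=
  .loop rRowCnt <|
    .seq (block [.fieldMul pCur pOne pOne, .natAdd rAddr rBase rZero, .natAdd rCnt rShift rZero]) <|
    .seq (geom pX) <|
    .seq (block [.natAdd rAddr rRow rZero, .natAdd rCnt rDim rZero]) <|
    .seq (geom pX) <|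
    block [.natAdd rRow rAddr rZero, .fieldMul pX pX pRatio, .natSub rRowCnt rRowCnt rOne]

theorem runs_writeRows {e : ℕ → F} {ω α : F} {n d q : ℕ} {s : State F} (hL : Layout n d s)
    (hω : s.mem (n * n + 3) = ω) (hα : s.mem (n * n + 2) = α) (hq : s.reg rShift = q)
    (hrow : s.reg rRow = 0) (hcnt : s.reg rRowCnt = n) :
    Runs e writeRows s (n * (5 * q + 5 * n + 11) + 1) fun s' =>
      ∀ a < n, ∀ b < n, s'.mem (a * n + b) = (ω ^ a * α) ^ (q + b) := by
  let I : ℕ → State F → Prop := fun m s' => ∃ a, m + a = n ∧ Layout n d s' ∧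
    s'.mem (n * n + 3) = ω ∧ s'.mem (n * n + 2) = ω ^ a * α ∧ s'.reg rShift = q ∧
    s'.reg rRow = a * n ∧ s'.reg rRowCnt = m ∧
    ∀ a' < a, ∀ b < n, s'.mem (a' * n + b) = (ω ^ a' * α) ^ (q + b)
  have hloop := Runs.loop (e := e) (r := rRowCnt) (I := I)
    (B := 3 + ((5 * q + 1) + (2 + ((5 * n + 1) + 3))))
    (P := .seq (block [.fieldMul pCur pOne pOne, .natAdd rAddr rBase rZero,
      .natAdd rCnt rShift rZero]) <| .seq (geom pX) <|
      .seq (block [.natAdd rAddr rRow rZero, .natAdd rCnt rDim rZero]) <| .seq (geom pX) <|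
      block [.natAdd rRow rAddr rZero, .fieldMul pX pX pRatio, .natSub rRowCnt rRowCnt rOne])
    (fun s h => by obtain ⟨a, -, -, -, -, -, -, h, -⟩ := h; exact h) (by
      rintro m s₁ ⟨a, hma, l1, w1, x1, q1, row1, cnt1, done1⟩
      have han : a * n + n ≤ n * n := by
        have : (a + 1) * n ≤ n * n := Nat.mul_le_mul_right _ (by omega)
        rwa [Nat.succ_mul] at this
      have hcell : ∀ a' < a, ∀ b < n, a' * n + b < a * n := fun a' h1 b h2 => by
        have : (a' + 1) * n ≤ a * n := Nat.mul_le_mul_right _ h1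
        rw [Nat.succ_mul] at this
        omega
      refine ⟨by omega, ?_⟩
      refine Runs.seq (Runs.block (Q := fun s₂ => Layout n d s₂ ∧
        (∀ r, r ≠ rAddr → r ≠ rCnt → s₂.reg r = s₁.reg r) ∧ s₂.reg rAddr = n * n + 6 ∧
        s₂.reg rCnt = q ∧ s₂.mem (n * n + 1) = 1 ∧
        ∀ k, k ≠ n * n + 1 → s₂.mem k = s₁.mem k) ⟨l1.congr ?_ ?_, ?_, ?_, ?_, ?_, ?_⟩) ?_
      · intro r hr
        simp (disch := omega) [Instr.apply, State.setReg, State.setMem, Function.update_of_ne]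
      · simp [Instr.apply, State.setReg, State.setMem, l1.ptrCur]
      · intro r h1 h2
        simp [Instr.apply, State.setReg, State.setMem, h1, h2]
      · simp [Instr.apply, State.setReg, State.setMem, l1.base, l1.zero]
      · simp [Instr.apply, State.setReg, State.setMem, q1, l1.zero]
      · simp [Instr.apply, State.setReg, State.setMem, State.get, l1.ptrCur, l1.ptrOne, l1.memOne]
      · intro k hk
        simp [Instr.apply, State.setReg, State.setMem, l1.ptrCur, hk]
      rintro s₂ ⟨l2, r2, a2, c2, cur2, m2⟩
      refine (runs_geom l2 (by decide) l2.ptrX (by omega) (by omega) a2 c2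
        (Or.inr le_rfl)).seq ?_
      rintro s₃ ⟨l3, r3, -, -, cur3, m3⟩
      rw [cur2, one_mul, m2 _ (by omega), x1] at cur3
      refine Runs.seq (Runs.block (Q := fun s₄ => Layout n d s₄ ∧
        (∀ r, r ≠ rAddr → r ≠ rCnt → s₄.reg r = s₃.reg r) ∧ s₄.reg rAddr = a * n ∧
        s₄.reg rCnt = n ∧ s₄.mem = s₃.mem) ⟨l3.congr ?_ ?_, ?_, ?_, ?_, ?_⟩) ?_
      · intro r hr
        simp (disch := omega) [Instr.apply, State.setReg, Function.update_of_ne]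
      · simp [Instr.apply, State.setReg]
      · intro r h1 h2
        simp [Instr.apply, State.setReg, h1, h2]
      · simp [Instr.apply, State.setReg, l3.zero, r3, r2, row1]
      · simp [Instr.apply, State.setReg, l3.zero, l3.dim]
      · simp [Instr.apply, State.setReg]
      rintro s₄ ⟨l4, r4, a4, c4, m4⟩
      refine (runs_geom l4 (by decide) l4.ptrX (by omega) (by omega) a4 c4
        (Or.inl han)).seq ?_
      rintro s₅ ⟨l5, r5, a5, w5, -, m5⟩
      have hreg : ∀ r, r ≠ rAddr → r ≠ rCnt → s₅.reg r = s₁.reg r := fun r h1 h2 => by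
        rw [r5 r h1 h2, r4 r h1 h2, r3 r h1 h2, r2 r h1 h2]
      have hmem : ∀ k, k ≠ n * n + 1 → (k < a * n ∨ n * n ≤ k ∧ k < n * n + 6) →
          s₅.mem k = s₁.mem k := fun k h1 h2 => by
        rw [m5 k h1 (by omega), m4, m3 k h1 (by omega), m2 k h1]
      have hx5 : s₅.mem (n * n + 2) = ω ^ a * α := (hmem _ (by omega) (by omega)).trans x1
      have hw5 : s₅.mem (n * n + 3) = ω := (hmem _ (by omega) (by omega)).trans w1
      rw [m4, cur3, m3 _ (by omega) (by omega), m2 _ (by omega), x1] at w5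
      refine Runs.block ⟨a + 1, by omega, l5.congr ?_ ?_, ?_, ?_, ?_, ?_, ?_, ?_⟩
      · intro r hr
        simp (disch := omega) [Instr.apply, State.setReg, State.setMem, Function.update_of_ne]
      · simp [Instr.apply, State.setReg, State.setMem, l5.ptrX]
      · simp [Instr.apply, State.setReg, State.setMem, l5.ptrX, hw5]
      · simp [Instr.apply, State.setReg, State.setMem, State.get, l5.ptrX, l5.ptrRatio, hw5, hx5]
        ring
      · simp [Instr.apply, State.setReg, State.setMem, hreg, q1]
      · simp [Instr.apply, State.setReg, State.setMem, a5, l5.zero, Nat.succ_mul]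
      · simp [Instr.apply, State.setReg, State.setMem, l5.one, hreg, cnt1]
      · intro a' ha' b hb
        rcases Nat.lt_succ_iff_lt_or_eq.1 ha' with h | rfl
        · have h1 := hcell a' h b hb
          have h2 : a' * n + b ≠ n * n + 2 := by omega
          simp [Instr.apply, State.setReg, State.setMem, l5.ptrX, h2]
          rw [hmem _ (by omega) (Or.inl h1), done1 a' h b hb]
        · have h2 : a' * n + b ≠ n * n + 2 := by omega
          simp [Instr.apply, State.setReg, State.setMem, l5.ptrX, h2]
          rw [w5 b hb, pow_add])
  refine (hloop n s ⟨0, rfl, hL, hω, by simp [hα], hq, by simp [hrow], hcnt, ?_⟩).mono ?_ ?_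
  · intro a' h
    omega
  · exact Nat.add_le_add_right (Nat.mul_le_mul_left _ (by omega)) 1
  · rintro s' ⟨a, ha, -, -, -, -, -, -, hdone⟩
    rw [zero_add] at ha
    subst ha
    exact hdone

/-- The program for a matrix other than the zero matrix, once the products of the parameters have
been computed. -/
def blockProg : Prog :=
  .seq (block [.natAdd pCur pOne rOne, .natAdd pX pCur rOne, .natAdd pRatio pX rOne,
    .natAdd pInv pRatio rOne, .natAdd pTmp pInv rOne, .natAdd rBase pTmp rOne, .fieldOne pOne]) <|
  .seq (find buildPowers) <|
  .seq (block [.fieldMul pRatio pX pOne, .fieldInv pInv pX, .natAdd rAddr rBase rZero,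
    .fieldZero rAddr, .natAdd rAddr rAddr rOne]) <|
  .seq choosePoints <| .seq (mulReg rShift rDim rRest) <|
  .seq (block [.natConst rRow 0, .natAdd rRowCnt rDim rZero]) writeRows

/-- A bound for the running time of `blockProg`, stated over any semiring so that it can be read
both as a number and as a polynomial. -/
def blockTime {R : Type*} [CommSemiring R] (n d : R) : R :=
  7 + ((n * d * (n * d) + 1) * (5 * (n * d) + 4 + 7 * (n * d) + 6) + 3) + 5 +
    (n * n * d + 1) * (10 * n + 13 +
      ((d ^ 2 * n ^ 3 + 1) * (7 * (1 + 2 * n * (n * n * d)) + 6) + 3)) +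
    (3 * d + 3) + 2 + (n * (5 * (n * d) + 5 * n + 11) + 1)

theorem runs_blockProg {e : ℕ → F} (he : IsListing e) {n d i : ℕ} (hd : 2 ≤ d) (hdn : d ≤ n)
    (hi : i < n * d * (n * d)) (hF : ((d ^ 2 * n ^ 3 : ℕ) : ℕ∞) < ENat.card F) {s : State F}
    (hdim : s.reg rDim = n) (hdeg : s.reg rDeg = d) (hone : s.reg rOne = 1)
    (hptr : s.reg pOne = n * n) (hlen : s.reg rLen = n * d) (hzero : s.reg rZero = 0)
    (hrest : s.reg rRest = i) :
    Runs e blockProg s (blockTime n d) fun s' =>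
      ∀ a b : Fin n, s'.mem ((a : ℕ) * n + (b : ℕ)) = expander e n d i a b := by
  have hN : 2 ≤ n * d := by nlinarith
  have hF' : ((n * d * (n * d) : ℕ) : ℕ∞) < ENat.card F := by
    refine lt_of_le_of_lt ?_ hF
    have : n * d * (n * d) * 1 ≤ n * d * (n * d) * n := Nat.mul_le_mul_left _ (by omega)
    exact_mod_cast (by calc n * d * (n * d) ≤ n * d * (n * d) * n := by omega
                        _ = d ^ 2 * n ^ 3 := by ring)
  obtain ⟨k, hkN, hk⟩ := exists_notMem_highPowers he hN hF'
  obtain ⟨k₀, hk1, hk2, hk3⟩ := firstFresh_eq ⟨k, hk⟩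
  have hk₀ : k₀ ≤ n * d * (n * d) := le_trans (not_lt.1 fun h => hk (hk3 k h)) hkN
  rw [← ratio] at hk1
  set ω := ratio e (n * d) with hω
  have hij : i / d < n * n * d := by
    rw [Nat.div_lt_iff_lt_mul (by omega)]
    calc i < n * d * (n * d) := hi
      _ = n * n * d * d := by ring
  have hbl : expander e n d i = condenserBlock n ω (point e ω n (i / d)) (i % d) := by
    rw [expander, if_pos ⟨hdn, hi⟩]
  refine Runs.mono (B := 7 + (((n * d * (n * d) + 1) * (5 * (n * d) + 4 + 7 * (n * d) + 6) + 3) +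
    (5 + ((n * n * d + 1) * (10 * n + 13 +
      ((d ^ 2 * n ^ 3 + 1) * (7 * (1 + 2 * n * (n * n * d)) + 6) + 3)) +
    ((3 * d + 3) + (2 + (n * (5 * (n * d) + 5 * n + 11) + 1)))))))
    ?_ (by unfold blockTime; omega) fun _ h => h
  refine Runs.seq (Runs.block (Q := fun s₁ => Layout n d s₁ ∧ s₁.reg rRest = i)
    ⟨⟨?_, ?_, ?_, ?_, ?_, ?_, ?_, ?_, ?_, ?_, ?_, ?_, ?_⟩, ?_⟩) ?_
  any_goals simp [Instr.apply, State.setReg, State.setMem, hdim, hdeg, hone, hptr, hlen, hzero,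
    hrest]
  rintro s₁ l1 rest1
  refine Runs.seq ((runs_find (L := n * d) (T := 5 * (n * d) + 4) hk2 hk3
    (Inv := fun s => Layout n d s ∧ s.reg rRest = i) (fun s h => h.1) ?_ ?_
    ⟨l1, rest1⟩).mono ?_ fun _ h => h) ?_
  · rintro s s' ⟨h1, h2⟩ hr hm
    exact ⟨h1.congr (fun r hr' => hr r (by omega) (by omega) (by omega) (by omega))
      (hm _ (by omega) (by omega)),
      (hr _ (by decide) (by decide) (by decide) (by decide)).trans h2⟩
  · rintro s ⟨h1, h2⟩
    refine (runs_buildPowers h1).mono le_rfl ?_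
    rintro s' ⟨h3, h4, h5, h6, h7⟩
    exact ⟨⟨h3, (h4 _ (by decide) (by decide)).trans h2⟩, h4 _ (by decide) (by decide), h5,
      n * d, le_rfl, h6, h7⟩
  · exact Nat.add_le_add_right (Nat.mul_le_mul_right _ (by omega)) 3
  rintro s₂ ⟨⟨l2, rest2⟩, x2⟩
  rw [← hk1] at x2
  refine Runs.seq (Runs.block (Q := fun s₃ => PointState e ω n d i 0 s₃)
    ⟨l2.congr ?_ ?_, ?_, ?_, ?_, ?_, ?_⟩) ?_
  · intro r hr
    simp (disch := omega) [Instr.apply, State.setReg, State.setMem, Function.update_of_ne]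
  · simp [Instr.apply, State.setReg, State.setMem, l2.ptrRatio, l2.ptrInv, l2.base, l2.zero]
  · simp [Instr.apply, State.setReg, State.setMem, State.get, l2.ptrRatio, l2.ptrInv, l2.base,
      l2.zero, l2.ptrX, l2.ptrOne, l2.memOne, x2]
  · simp [Instr.apply, State.setReg, State.setMem, State.get, l2.ptrRatio, l2.ptrInv, l2.base,
      l2.zero, l2.ptrX, x2]
  · simp [Instr.apply, State.setReg, State.setMem, l2.base, l2.zero, l2.one]
  · ext y
    simp only [cellSet, forbidden, Set.mem_ofPred_eq, Set.mem_singleton_iff, mul_zero, add_zero]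
    constructor
    · rintro ⟨k, h1, h2, rfl⟩
      obtain rfl : k = n * n + 6 := by omega
      simp [Instr.apply, State.setReg, State.setMem, l2.base, l2.zero]
    · rintro rfl
      refine ⟨n * n + 6, le_rfl, by omega, ?_⟩
      simp [Instr.apply, State.setReg, State.setMem, l2.base, l2.zero]
  · simpa [Instr.apply, State.setReg, State.setMem] using rest2
  intro s₃ hs₃
  refine (runs_choosePoints (J := n * n * d) (K := d ^ 2 * n ^ 3) (by omega) hij.le
    (fun j hj => exists_notMem_forbidden he ω hd hF (by omega)) hs₃).seq ?_
  rintro s₄ ⟨p4, x4⟩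
  have l4 := p4.layout
  have rest4 : s₄.reg rRest = i % d := by
    have h1 := p4.rest
    have h2 := Nat.div_add_mod i d
    omega
  have hmod : i % d ≤ d := (Nat.mod_lt i (by omega)).le
  refine Runs.seq ((runs_mulReg (r := rShift) (a := rDim) (b := rRest) l4.one l4.zero (by decide)
    (by decide) (by decide) (by decide) (by decide) (by decide)).mono
    (by rw [rest4]; omega) fun _ h => h) ?_
  rintro s₅ ⟨q5, r5, m5⟩
  rw [l4.dim, rest4] at q5
  have l5 : Layout n d s₅ := l4.congr (fun r hr => r5 r (by omega) (by omega)) (by rw [m5])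
  refine Runs.seq (Runs.block (Q := fun s₆ => Layout n d s₆ ∧ s₆.mem = s₅.mem ∧
    s₆.reg rShift = n * (i % d) ∧ s₆.reg rRow = 0 ∧ s₆.reg rRowCnt = n)
    ⟨l5.congr ?_ ?_, ?_, ?_, ?_, ?_⟩) ?_
  · intro r hr
    simp (disch := omega) [Instr.apply, State.setReg, Function.update_of_ne]
  · simp [Instr.apply, State.setReg]
  · simp [Instr.apply, State.setReg]
  · simpa [Instr.apply, State.setReg] using q5
  · simp [Instr.apply, State.setReg]
  · simp [Instr.apply, State.setReg, l5.dim, l5.zero]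
  rintro s₆ ⟨l6, m6, q6, row6, cnt6⟩
  refine (runs_writeRows l6 (by rw [m6, m5, p4.ratio]) (by rw [m6, m5, x4]) q6 row6
    cnt6).mono ?_ ?_
  · have : n * (i % d) ≤ n * d := Nat.mul_le_mul_left n hmod
    exact Nat.add_le_add_right (Nat.mul_le_mul_left n (by omega)) 1
  · intro s₇ h7 a b
    rw [h7 a a.2 b b.2, hbl]
    rfl

/-- The program: it leaves the memory untouched, hence zero, when the matrix to be constructed is
zero. -/
def expanderProg : Prog :=
  .seq (block [.natSub rTest rDeg rDim]) <| .ifNat rTest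
    (.seq (block [.natConst rOne 1, .natAdd rRest rIndex rZero]) <|
      .seq (mulReg pOne rDim rDim) <| .seq (mulReg rLen rDim rDeg) <|
      .seq (mulReg rShift rLen rLen) <| .seq (block [.natSub rTest rShift rRest]) <|
      .ifNat rTest .skip blockProg)
    .skip

/-- A bound for the running time of `expanderProg`. -/
def expanderTime {R : Type*} [CommSemiring R] (n d : R) : R :=
  1 + (2 + (3 * n + 3) + (3 * d + 3) + (3 * (n * d) + 3) + 1 + (blockTime n d + 1) + 1)

/-- The running time depends on `d` only through `min d n`, since the program stops at once if
`d > n`. -/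
theorem runs_expanderProg {e : ℕ → F} (he : IsListing e) {n d i M : ℕ} (hd : 2 ≤ d)
    (hF : ((d ^ 2 * n ^ 3 : ℕ) : ℕ∞) < ENat.card F) :
    Runs e expanderProg (State.init [n, i, d, M]) (expanderTime n (min d n)) fun s' =>
      ∀ a b : Fin n, s'.mem ((a : ℕ) * n + (b : ℕ)) = expander e n d i a b := by
  refine Runs.seq (Runs.block (Q := fun s₁ => s₁.reg rTest = d - n ∧ s₁.reg rDim = n ∧
    s₁.reg rIndex = i ∧ s₁.reg rDeg = d ∧ s₁.reg rZero = 0 ∧ s₁.mem = fun _ => 0)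
    ⟨?_, ?_, ?_, ?_, ?_, ?_⟩) ?_
  any_goals simp [Instr.apply, State.setReg, State.init]
  intro s₁ t1 dim1 idx1 deg1 zero1 mem1
  refine Runs.ifNat (fun h => ?_) fun h => (Runs.skip ?_).mono (Nat.zero_le _) fun _ h => h
  · have hdn : d ≤ n := by omega
    rw [min_eq_left hdn]
    refine Runs.mono (B := 2 + ((3 * n + 3) + ((3 * d + 3) + ((3 * (n * d) + 3) +
      (1 + (blockTime n d + 1)))))) ?_ (by omega) fun _ h => h
    refine Runs.seq (Runs.block (Q := fun s₂ => s₂.reg rOne = 1 ∧ s₂.reg rDim = n ∧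
      s₂.reg rRest = i ∧ s₂.reg rDeg = d ∧ s₂.reg rZero = 0 ∧ s₂.mem = fun _ => 0)
      ⟨?_, ?_, ?_, ?_, ?_, ?_⟩) ?_
    any_goals simp [Instr.apply, State.setReg, dim1, idx1, deg1, zero1, mem1]
    intro s₂ one2 dim2 rest2 deg2 zero2 mem2
    refine Runs.seq ((runs_mulReg one2 zero2 (by decide) (by decide) (by decide) (by decide)
      (by decide) (by decide)).mono (by rw [dim2]) fun _ h => h) ?_
    rintro s₃ ⟨p3, r3, m3⟩
    refine Runs.seq ((runs_mulReg ((r3 _ (by decide) (by decide)).trans one2)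
      ((r3 _ (by decide) (by decide)).trans zero2) (by decide) (by decide) (by decide) (by decide)
      (by decide) (by decide)).mono
      (by rw [r3 _ (by decide) (by decide), deg2]) fun _ h => h) ?_
    rintro s₄ ⟨p4, r4, m4⟩
    have hlen : s₄.reg rLen = n * d := by
      rw [p4, r3 _ (by decide) (by decide), r3 _ (by decide) (by decide), dim2, deg2]
    refine Runs.seq ((runs_mulReg
      ((r4 _ (by decide) (by decide)).trans ((r3 _ (by decide) (by decide)).trans one2))
      ((r4 _ (by decide) (by decide)).trans ((r3 _ (by decide) (by decide)).trans zero2))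
      (by decide) (by decide) (by decide) (by decide)
      (by decide) (by decide)).mono (by rw [hlen]) fun _ h => h) ?_
    rintro s₅ ⟨p5, r5, m5⟩
    rw [hlen] at p5
    have hreg : ∀ r, r ≠ pOne → r ≠ rLen → r ≠ rShift → r ≠ rTest → s₅.reg r = s₂.reg r :=
      fun r h1 h2 h3 h4 => (r5 r h3 h4).trans ((r4 r h2 h4).trans (r3 r h1 h4))
    have hrest : s₅.reg rRest = i :=
      (hreg _ (by decide) (by decide) (by decide) (by decide)).trans rest2
    refine Runs.seq (Runs.block (Q := fun s₆ => s₆.reg rTest = n * d * (n * d) - i ∧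
      (∀ r, r ≠ rTest → s₆.reg r = s₅.reg r) ∧ s₆.mem = s₅.mem) ⟨?_, ?_, ?_⟩) ?_
    · simp [Instr.apply, State.setReg, p5, hrest]
    · intro r hr
      simp [Instr.apply, State.setReg, hr]
    · simp [Instr.apply, State.setReg]
    rintro s₆ ⟨t6, r6, m6⟩
    have hreg6 : ∀ r, r ≠ pOne → r ≠ rLen → r ≠ rShift → r ≠ rTest → s₆.reg r = s₂.reg r :=
      fun r h1 h2 h3 h4 => (r6 r h4).trans (hreg r h1 h2 h3 h4)
    refine Runs.ifNat (fun h' => (Runs.skip ?_).mono (Nat.zero_le _) fun _ h => h) fun h' => ?_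
    · intro a b
      rw [expander, if_neg (by omega), m6, m5, m4, m3, mem2]
      rfl
    · refine runs_blockProg he hd hdn (by omega) hF ?_ ?_ ?_ ?_ ?_ ?_ ?_
      · rw [hreg6 _ (by decide) (by decide) (by decide) (by decide), dim2]
      · rw [hreg6 _ (by decide) (by decide) (by decide) (by decide), deg2]
      · rw [hreg6 _ (by decide) (by decide) (by decide) (by decide), one2]
      · rw [r6 _ (by decide), r5 _ (by decide) (by decide), r4 _ (by decide) (by decide), p3, dim2]
      · rw [r6 _ (by decide), r5 _ (by decide) (by decide), hlen]
      · rw [hreg6 _ (by decide) (by decide) (by decide) (by decide), zero2]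
      · rw [hreg6 _ (by decide) (by decide) (by decide) (by decide), rest2]
  · intro a b
    rw [expander, if_neg (by omega), mem1]
    rfl

theorem expanderTime_mono {n d m : ℕ} (hn : n ≤ m) (hd : d ≤ m) :
    expanderTime n d ≤ expanderTime m m := by
  unfold expanderTime blockTime
  gcongr

theorem eval_expanderTime (m : ℕ) :
    (expanderTime Polynomial.X Polynomial.X : Polynomial ℕ).eval m = expanderTime m m := by
  simp [expanderTime, blockTime]

end DimExp

theorem mainTheorem2 :
    ∃ (P : DimExp.Prog) (p : Polynomial ℕ),
      ∀ (F : Type*) [Field F] (e : ℕ → F), DimExp.IsListing e →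
      ∀ (n : ℕ) (ε η : ℝ), 1 ≤ n → 0 < ε → ε ≤ η → η < 1 →
      ∀ d M : ℕ, d = ⌈(1 + η) / (2 * ε)⌉₊ → M = ⌈2 * (1 + η) * (d : ℝ) / (1 - η) ^ 2⌉₊ →
        ((d ^ 2 * n ^ 3 : ℕ) : ℕ∞) < ENat.card F →
        d * M ≤ ⌈1 / ε⌉₊ * ⌈4 * (⌈1 / ε⌉₊ : ℝ) / (1 - η) ^ 2⌉₊ ∧
        ∃ A : Fin (d * M) → Matrix (Fin n) (Fin n) F,
          DimExp.IsDimensionExpander ε (η / ε) A ∧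
          DimExp.ExplicitBy P p e [d, M] A := by
  refine ⟨DimExp.expanderProg, DimExp.expanderTime Polynomial.X Polynomial.X, ?_⟩
  intro F _ e he n ε η _ hε hεη hη d M hd hM hF
  refine ⟨DimExp.degree_le hε hη hd hM, fun i => DimExp.expander e n d i,
    DimExp.isDimensionExpander_expander he hε hεη hη hd hM hF, fun i => ?_⟩
  obtain ⟨T, s, hT, hE, hs⟩ := DimExp.runs_expanderProg (i := i) (M := M) he
    (hd ▸ DimExp.two_le_ceil hε hεη hη) hF
  refine ⟨T, hT.trans ?_, s, hE, hs⟩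
  rw [DimExp.eval_expanderTime]
  exact DimExp.expanderTime_mono (Nat.le_add_right _ _)
    ((min_le_right _ _).trans (Nat.le_add_right _ _))
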